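/- Throughout, an operator system is an abstract unital operator system (a complex $*$-vector space with proper matrix cones and an Archimedean matrix order unit $1$), equipped with its order norm $\|a\|=\inf\{\lambda>0 : \begin{bmatrix}\lambda 1&a\\a^*&\lambda 1\end{bmatrix}\ge 0\}$; it need not be norm complete. It is nuclear if there is a net of completely positive contractions $\psi_i:\mathcal S\to M_{\nu_i}(\mathbb C)$, $\varphi_i:M_{\nu_i}(\mathbb C)\to\mathcal S$ with $\varphi_i\circ\psi_i\to\mathrm{id}_{\mathcal S}$ in the point-norm topology. A soft inductive system $(\mathcal S_n,j)$ of operator systems over a directed set $N$ consists of operator systems $\mathcal S_n$ and unital completely positive (ucp) maps $j_{nm}:\mathcal S_m\to\mathcal S_n$ for $n>m$ (extended by $j_{nn}=\mathrm{id}$ and $j_{nm}=0$ if $n\not\ge m$) such that $\lim_m\limsup_n\|(j_{nl}-j_{nm}j_{ml})a\|=0$ for all $l\in N$, $a\in\mathcal S_l$. It is strict if $j_{nm}j_{ml}=j_{nl}$ for all $n>m>l$. A uniformly bounded net $(a_n)_{n\in N}$, $a_n\in\mathcal S_n$, is $j$-convergent if $\lim_m\limsup_n\|a_n-j_{nm}a_m\|=0$,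 and null if $\lim_n\|a_n\|=0$. The limit space $\mathcal S_\infty$ is the space $\mathcal C$ of $j$-convergent nets modulo the space $\mathcal C_0$ of null nets, with quotient map $j\text{-}\lim$; it is an operator system, an element of $M_k(\mathcal S_\infty)$ being positive if it has a lift $a\in M_k(\mathcal C)$ such that for every $\varepsilon>0$ there is $b\in M_k(\mathcal C_0)$ with $\varepsilon 1+a_n+b_n\ge0$ for all $n$. The system is split if there is a linear contraction $s:\mathcal S_\infty\to\mathcal C$ (supremum norm on $\mathcal C$) with ucp components and with $j\text{-}\lim s(x)=x$ for all $x\in\mathcal S_\infty$. Say that an operator system $\mathcal S$ is the limit of such a system if there is a unital complete order embedding $\mathcal S\to\mathcal S_\infty$ with norm-dense range which, in case $\mathcal S$ is norm complete, is a complete order isomorphism onto $\mathcal S_\infty$. Theorem. Let $\mathcal S\neq 0$ be a nuclear operator system. Then there are a directed set $N$ and a split soft inductive system over $N$, with every $\mathcal S_n$ a full matrix algebra $M_{\nu_n}(\mathbb C)$, $\nu_n\ge1$, such that $\mathcal S$ is its limit. If $\mathcal S$ is separable, then one can take $N=\mathbb N$ with the usual order, and the system can be chosen to be strict and split. -/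

import Mathlib

open Filter Topology
open scoped ComplexOrder

universe u v w

/-- The compression `X⋆ A X` of a matrix `A` over a complex vector space by a scalar matrix `X`. -/
def matCompress {S : Type u} [AddCommGroup S] [Module ℂ S] {n m : ℕ}
    (X : Matrix (Fin n) (Fin m) ℂ) (A : Matrix (Fin n) (Fin n) S) : Matrix (Fin m) (Fin m) S :=
  Matrix.of fun i j => ∑ k, ∑ l, (star (X k i) * X l j) • A k l

/-- An (abstract, unital) operator system: a complex `*`-vector space `S` with a distinguished
element `1` and a cone `pos n` of positive elements in each matrix space `M_n(S)`, such that the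
cones are proper, consist of self-adjoint elements, are compatible with compression by scalar
matrices, and `1` is an Archimedean matrix order unit. No completeness is required. -/
class OperatorSystem (S : Type u) extends
    AddCommGroup S, Module ℂ S, StarAddMonoid S, StarModule ℂ S, One S where
  /-- the cone of positive elements of `M_n(S)` -/
  pos : ∀ n : ℕ, Set (Matrix (Fin n) (Fin n) S)
  pos_isHermitian : ∀ {n : ℕ} {A : Matrix (Fin n) (Fin n) S}, A ∈ pos n → A.IsHermitian
  pos_add : ∀ {n : ℕ} {A B : Matrix (Fin n) (Fin n) S}, A ∈ pos n → B ∈ pos n → A + B ∈ pos n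
  pos_smul : ∀ {n : ℕ} {A : Matrix (Fin n) (Fin n) S} {r : ℝ}, 0 ≤ r → A ∈ pos n →
    (r : ℂ) • A ∈ pos n
  pos_proper : ∀ {n : ℕ} {A : Matrix (Fin n) (Fin n) S}, A ∈ pos n → -A ∈ pos n → A = 0
  pos_compress : ∀ {n m : ℕ} (X : Matrix (Fin n) (Fin m) ℂ) {A : Matrix (Fin n) (Fin n) S},
    A ∈ pos n → matCompress X A ∈ pos m
  star_one : star (1 : S) = 1
  order_unit : ∀ {n : ℕ} {A : Matrix (Fin n) (Fin n) S}, A.IsHermitian →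
    ∃ r : ℝ, 0 < r ∧ (r : ℂ) • (1 : Matrix (Fin n) (Fin n) S) + A ∈ pos n
  archimedean : ∀ {n : ℕ} {A : Matrix (Fin n) (Fin n) S},
    (∀ r : ℝ, 0 < r → (r : ℂ) • (1 : Matrix (Fin n) (Fin n) S) + A ∈ pos n) → A ∈ pos n

namespace OperatorSystem

section Norm

variable {S : Type u} [OperatorSystem S]

/-- The `2 × 2` matrix with diagonal entries `r1` and off-diagonal entries `a`, `a⋆`. -/
def block (r : ℝ) (a : S) : Matrix (Fin 2) (Fin 2) S :=
  !![(r : ℂ) • 1, a; star a, (r : ℂ) • 1]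

/-- The order norm of an operator system. -/
noncomputable def orderNorm (a : S) : ℝ := sInf {r : ℝ | 0 < r ∧ block r a ∈ pos 2}

theorem one_isHermitian (n : ℕ) : (1 : Matrix (Fin n) (Fin n) S).IsHermitian := by
  ext i j
  by_cases h : i = j
  · subst h; simp [star_one]
  · simp [h, Ne.symm h]

theorem zero_mem (n : ℕ) : (0 : Matrix (Fin n) (Fin n) S) ∈ pos n := by
  obtain ⟨r, hr, h⟩ := order_unit (S := S) (Matrix.isHermitian_zero (n := Fin n))
  have := pos_smul (r := 0) le_rfl h
  simpa using this

theorem one_mem (n : ℕ) : (1 : Matrix (Fin n) (Fin n) S) ∈ pos n := by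
  obtain ⟨r, hr, h⟩ := order_unit (S := S) (Matrix.isHermitian_zero (n := Fin n))
  have := pos_smul (r := r⁻¹) (by positivity) h
  rw [add_zero, smul_smul, ← Complex.ofReal_mul, inv_mul_cancel₀ hr.ne'] at this
  simpa using this

theorem sum_mem {ι : Type*} {n : ℕ} (s : Finset ι) (f : ι → Matrix (Fin n) (Fin n) S)
    (h : ∀ i ∈ s, f i ∈ pos n) : ∑ i ∈ s, f i ∈ pos n := by
  classical
  induction s using Finset.induction_on with
  | empty => simpa using zero_mem n
  | insert a s ha ih =>
    rw [Finset.sum_insert ha]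
    exact pos_add (h _ (Finset.mem_insert_self _ _))
      (ih fun i hi => h i (Finset.mem_insert_of_mem hi))

theorem smul_one_add_mono {n : ℕ} {r s : ℝ} {A : Matrix (Fin n) (Fin n) S} (hrs : r ≤ s)
    (h : (r : ℂ) • (1 : Matrix (Fin n) (Fin n) S) + A ∈ pos n) :
    (s : ℂ) • (1 : Matrix (Fin n) (Fin n) S) + A ∈ pos n := by
  have h2 := pos_add (pos_smul (sub_nonneg.2 hrs) (one_mem (S := S) n)) h
  have e : ((s - r : ℝ) : ℂ) • (1 : Matrix (Fin n) (Fin n) S)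
      + ((r : ℂ) • (1 : Matrix (Fin n) (Fin n) S) + A) = (s : ℂ) • 1 + A := by
    push_cast; module
  rwa [e] at h2

theorem block_eq (r : ℝ) (a : S) :
    block r a = (r : ℂ) • (1 : Matrix (Fin 2) (Fin 2) S) + block 0 a := by
  ext i j
  fin_cases i <;> fin_cases j <;> simp [block]

theorem block_mono {r s : ℝ} {a : S} (hrs : r ≤ s) (h : block r a ∈ pos 2) :
    block s a ∈ pos 2 := by
  rw [block_eq] at h ⊢
  exact smul_one_add_mono hrs h

theorem block_isHermitian (r : ℝ) (a : S) : (block r a).IsHermitian := by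
  ext i j
  fin_cases i <;> fin_cases j <;> simp [block, star_one]

theorem orderNorm_set_nonempty (a : S) : {r : ℝ | 0 < r ∧ block r a ∈ pos 2}.Nonempty := by
  obtain ⟨r, hr, h⟩ := order_unit (block_isHermitian 0 a)
  exact ⟨r, hr, by rwa [block_eq]⟩

theorem orderNorm_le {a : S} {r : ℝ} (hr : 0 < r) (h : block r a ∈ pos 2) : orderNorm a ≤ r :=
  csInf_le ⟨0, fun _ hx => hx.1.le⟩ ⟨hr, h⟩

theorem block_mem_of_lt {a : S} {r : ℝ} (h : orderNorm a < r) : block r a ∈ pos 2 := by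
  obtain ⟨s, ⟨_, hs⟩, hsr⟩ := exists_lt_of_csInf_lt (orderNorm_set_nonempty a) h
  exact block_mono hsr.le hs

theorem orderNorm_nonneg (a : S) : 0 ≤ orderNorm a :=
  le_csInf (orderNorm_set_nonempty a) fun _ hx => hx.1.le

theorem orderNorm_zero : orderNorm (0 : S) = 0 := by
  refine le_antisymm (le_of_forall_pos_le_add fun ε hε => ?_) (orderNorm_nonneg _)
  rw [zero_add]
  refine orderNorm_le hε ?_
  have h := pos_smul hε.le (one_mem (S := S) 2)
  rw [block_eq]
  have : block 0 (0 : S) = 0 := by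
    ext i j; fin_cases i <;> fin_cases j <;> simp [block]
  rwa [this, add_zero]

theorem orderNorm_add_le (a b : S) : orderNorm (a + b) ≤ orderNorm a + orderNorm b := by
  refine le_of_forall_pos_le_add fun ε hε => ?_
  have ha := block_mem_of_lt (a := a) (r := orderNorm a + ε / 2) (by linarith)
  have hb := block_mem_of_lt (a := b) (r := orderNorm b + ε / 2) (by linarith)
  have h := pos_add ha hb
  have e : block (orderNorm a + ε / 2) a + block (orderNorm b + ε / 2) b
      = block (orderNorm a + orderNorm b + ε) (a + b) := by
    ext i j
    fin_cases i <;> fin_cases j <;> simp [block, ← add_smul] <;> congr 1 <;> ring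
  rw [e] at h
  exact orderNorm_le (by linarith [orderNorm_nonneg a, orderNorm_nonneg b]) h

theorem orderNorm_smul_le (c : ℂ) (a : S) : orderNorm (c • a) ≤ ‖c‖ * orderNorm a := by
  rcases eq_or_ne c 0 with rfl | hc
  · simp [orderNorm_zero]
  have hc' : 0 < ‖c‖ := norm_pos_iff.2 hc
  rw [← div_le_iff₀' hc']
  refine le_of_forall_pos_le_add fun ε hε => ?_
  rw [div_le_iff₀' hc']
  have ha := block_mem_of_lt (a := a) (r := orderNorm a + ε) (by linarith)
  have h0 := orderNorm_nonneg a
  refine orderNorm_le (by positivity) ?_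
  have h := pos_smul hc'.le (pos_compress !![1, 0; 0, c / ‖c‖] ha)
  have hn : (‖c‖ : ℂ) ≠ 0 := by exact_mod_cast hc'.ne'
  have h1 : (‖c‖ : ℂ) * (c / ‖c‖) = c := by field_simp
  have h2 : (‖c‖ : ℂ) * (star c / ‖c‖) = star c := by field_simp
  have h3 : star c / ‖c‖ * (c / ‖c‖) = 1 := by
    have : star c * c = (‖c‖ : ℂ) * ‖c‖ := by
      have := Complex.conj_mul' c
      simpa [sq] using this
    field_simp
    simpa [sq] using this
  convert h using 1
  ext i j
  fin_cases i <;> fin_cases j <;>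
    simp [block, matCompress, Fin.sum_univ_two, smul_smul] at * <;> simp only [h1, h2, h3, one_mul]

theorem eq_zero_of_orderNorm_eq_zero (a : S) (h : orderNorm a = 0) : a = 0 := by
  have h1 : block 0 a ∈ pos 2 := archimedean fun r hr => by
    rw [← block_eq]; exact block_mem_of_lt (by rwa [h])
  have h2 := pos_compress !![1, 0; 0, -1] h1
  have e : matCompress !![1, 0; 0, -1] (block 0 a) = -block 0 a := by
    ext i j
    fin_cases i <;> fin_cases j <;> simp [block, matCompress, Fin.sum_univ_two]
  rw [e] at h2
  have := congrFun (congrFun (pos_proper h1 h2) 0) 1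
  simpa [block] using this

/-- Every operator system carries its order norm. -/
noncomputable instance instNormedAddCommGroup : NormedAddCommGroup S :=
  AddGroupNorm.toNormedAddCommGroup
    { toFun := orderNorm
      map_zero' := orderNorm_zero
      add_le' := orderNorm_add_le
      neg' := fun a => by
        refine le_antisymm ?_ ?_
        · simpa using orderNorm_smul_le (-1) a
        · simpa using orderNorm_smul_le (-1) (-a)
      eq_zero_of_map_eq_zero' := eq_zero_of_orderNorm_eq_zero }

noncomputable instance instNormedSpace : NormedSpace ℂ S where
  norm_smul_le := orderNorm_smul_le

theorem norm_def (a : S) : ‖a‖ = sInf {r : ℝ | 0 < r ∧ block r a ∈ pos 2} := rfl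

end Norm

end OperatorSystem

namespace OperatorSystem

section Bounds

variable {S : Type u} [OperatorSystem S]

theorem norm_le_of_block {a : S} {r : ℝ} (hr : 0 < r) (h : block r a ∈ pos 2) : ‖a‖ ≤ r :=
  orderNorm_le hr h

theorem block_mem_of_norm_lt {a : S} {r : ℝ} (h : ‖a‖ < r) : block r a ∈ pos 2 :=
  block_mem_of_lt h

theorem add_mem_of_norm_lt {k : ℕ} {d : Matrix (Fin k) (Fin k) S} (hd : d.IsHermitian) {δ : ℝ}
    (h : ∀ i j, ‖d i j‖ < δ) :
    ((k * δ : ℝ) : ℂ) • (1 : Matrix (Fin k) (Fin k) S) + d ∈ pos k := by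
  have h1 : ∀ i j, matCompress (Matrix.of ![Pi.single i 1, Pi.single j 1]) (block δ (d i j))
      ∈ pos k := fun i j => pos_compress _ (block_mem_of_norm_lt (h i j))
  have h2 := pos_smul (r := 1 / 2) (by norm_num) (sum_mem Finset.univ _ fun i _ =>
    sum_mem Finset.univ _ fun j _ => h1 i j)
  convert h2 using 1
  ext p q
  have hpq : star (d q p) = d p q := hd.apply p q
  simp only [Matrix.add_apply, Matrix.smul_apply, Matrix.sum_apply, matCompress, Matrix.of_apply,
    Fin.sum_univ_two, block]
  simp [Pi.single_apply, Finset.sum_add_distrib, Matrix.one_apply, hpq]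
  split_ifs <;> module

theorem matCompress_select {n m : ℕ} (u : Fin m → Fin n) (z : Fin m → ℂ)
    (A : Matrix (Fin n) (Fin n) S) (p q : Fin m) :
    matCompress (Matrix.of fun k p => if k = u p then z p else 0) A p q
      = (star (z p) * z q) • A (u p) (u q) := by
  simp only [matCompress, Matrix.of_apply, apply_ite star, star_zero, ite_mul, zero_mul,
    mul_ite, mul_zero, ite_smul, zero_smul]
  simp

theorem norm_apply_le {k : ℕ} {c : Matrix (Fin k) (Fin k) S} {r : ℝ} (hr : 0 < r)
    (h1 : (r : ℂ) • (1 : Matrix (Fin k) (Fin k) S) + c ∈ pos k)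
    (h2 : (r : ℂ) • (1 : Matrix (Fin k) (Fin k) S) - c ∈ pos k) (i j : Fin k) :
    ‖c i j‖ ≤ r := by
  refine norm_le_of_block hr ?_
  have hc : star (c i j) = c j i := by
    have := pos_isHermitian h1
    have h3 := (this.sub ((one_isHermitian (S := S) k).smul (k := (r : ℂ)) (by
      simp [IsSelfAdjoint]))).apply j i
    simpa using h3
  have h := pos_smul (r := 1 / 2) (by norm_num) (pos_add
    (pos_compress (Matrix.of fun p q => if p = ![i, j] q then ![1, 1] q else 0) h1)
    (pos_compress (Matrix.of fun p q => if p = ![i, j] q then ![1, -1] q else 0) h2))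
  convert h using 1
  ext p q
  rw [Matrix.smul_apply, Matrix.add_apply, matCompress_select, matCompress_select]
  fin_cases p <;> fin_cases q <;>
    simp [block, hc, -Complex.coe_smul] <;> module

end Bounds

end OperatorSystem

section Maps

variable {S : Type u} {T : Type v} [OperatorSystem S] [OperatorSystem T]

/-- Complete positivity: all matrix amplifications of `f` preserve positivity. -/
def IsCompletelyPositive (f : S →ₗ[ℂ] T) : Prop :=
  ∀ (n : ℕ) (A : Matrix (Fin n) (Fin n) S),
    A ∈ OperatorSystem.pos n → A.map f ∈ OperatorSystem.pos n

/-- Unital completely positive maps. -/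
structure IsUCP (f : S →ₗ[ℂ] T) : Prop where
  map_one : f 1 = 1
  cp : IsCompletelyPositive f

/-- Contractive completely positive maps. -/
structure IsCPC (f : S →ₗ[ℂ] T) : Prop where
  contractive : ∀ a, ‖f a‖ ≤ ‖a‖
  cp : IsCompletelyPositive f

/-- Unital complete order embeddings. -/
structure IsCompleteOrderEmbedding (f : S →ₗ[ℂ] T) : Prop where
  map_one : f 1 = 1
  map_mem_iff : ∀ (n : ℕ) (A : Matrix (Fin n) (Fin n) S),
    A.map f ∈ OperatorSystem.pos n ↔ A ∈ OperatorSystem.pos n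

/-- Unital complete order isomorphisms. -/
structure IsCompleteOrderIso (f : S →ₗ[ℂ] T) : Prop extends IsCompleteOrderEmbedding f where
  bijective : Function.Bijective f

theorem IsCompletelyPositive.map_star {f : S →ₗ[ℂ] T} (hf : IsCompletelyPositive f) (a : S) :
    f (star a) = star (f a) := by
  have h := OperatorSystem.block_mem_of_norm_lt (lt_add_one ‖a‖)
  have := (OperatorSystem.pos_isHermitian (hf 2 _ h)).apply 1 0
  simpa [OperatorSystem.block] using this.symm

theorem IsUCP.norm_map_le {f : S →ₗ[ℂ] T} (hf : IsUCP f) (a : S) : ‖f a‖ ≤ ‖a‖ := by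
  refine le_of_forall_pos_le_add fun ε hε => ?_
  refine OperatorSystem.norm_le_of_block (by positivity) ?_
  have h := hf.cp 2 _ (OperatorSystem.block_mem_of_norm_lt (lt_add_of_pos_right ‖a‖ hε))
  convert h using 1
  ext i j
  fin_cases i <;> fin_cases j <;>
    simp [OperatorSystem.block, hf.map_one, hf.cp.map_star, -Complex.coe_smul]

theorem OperatorSystem.norm_star_le (a : S) : ‖star a‖ ≤ ‖a‖ := by
  refine le_of_forall_pos_le_add fun ε hε => ?_
  refine OperatorSystem.norm_le_of_block (by positivity) ?_
  have h := OperatorSystem.pos_compress !![0, 1; 1, 0]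
    (OperatorSystem.block_mem_of_norm_lt (lt_add_of_pos_right ‖a‖ hε))
  convert h using 1
  ext i j
  fin_cases i <;> fin_cases j <;>
    simp [OperatorSystem.block, matCompress, -Complex.coe_smul]

end Maps

section MatrixAlgebra

open scoped Matrix.Norms.L2Operator MatrixOrder in
theorem matrix_order_unit {n : Type*} [Fintype n] [DecidableEq n] {H : Matrix n n ℂ}
    (hH : H.IsHermitian) :
    ∃ r : ℝ, 0 < r ∧ ((r : ℂ) • (1 : Matrix n n ℂ) + H).PosSemidef := by
  refine ⟨‖H‖ + 1, by positivity, ?_⟩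
  have h1 := IsSelfAdjoint.neg_algebraMap_norm_le_self (a := H) hH
  have h2 : (0 : Matrix n n ℂ) ≤ algebraMap ℝ (Matrix n n ℂ) ‖H‖ + H := by
    have := add_le_add_right h1 (algebraMap ℝ (Matrix n n ℂ) ‖H‖)
    simpa using this
  have h3 := (Matrix.nonneg_iff_posSemidef.1 h2).add Matrix.PosSemidef.one
  have e : algebraMap ℝ (Matrix n n ℂ) ‖H‖ + H + 1
      = ((‖H‖ + 1 : ℝ) : ℂ) • (1 : Matrix n n ℂ) + H := by
    rw [Algebra.algebraMap_eq_smul_one, Complex.coe_smul, add_smul, one_smul]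
    abel
  exact e ▸ h3

open scoped MatrixOrder in
theorem matrix_proper {n : Type*} [Fintype n] {H : Matrix n n ℂ}
    (h1 : H.PosSemidef) (h2 : (-H).PosSemidef) : H = 0 :=
  le_antisymm (neg_nonneg.1 (Matrix.nonneg_iff_posSemidef.2 h2))
    (Matrix.nonneg_iff_posSemidef.2 h1)

theorem matrix_archimedean {n : Type*} [Fintype n] [DecidableEq n] {H : Matrix n n ℂ}
    (h : ∀ r : ℝ, 0 < r → ((r : ℂ) • (1 : Matrix n n ℂ) + H).PosSemidef) : H.PosSemidef := by
  have hH : H.IsHermitian := by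
    have h1 := (h 1 one_pos).1.sub (Matrix.isHermitian_one (α := ℂ) (n := n))
    simpa using h1
  refine Matrix.PosSemidef.of_dotProduct_mulVec_nonneg hH fun x => ?_
  have hre : ∀ r : ℝ, 0 < r → 0 ≤ (r : ℂ) * (star x ⬝ᵥ x) + star x ⬝ᵥ (H.mulVec x) := by
    intro r hr
    have := (h r hr).dotProduct_mulVec_nonneg x
    simpa [Matrix.add_mulVec, Matrix.smul_mulVec, dotProduct_add] using this
  have hlim : Tendsto (fun r : ℝ => (r : ℂ) * (star x ⬝ᵥ x) + star x ⬝ᵥ (H.mulVec x))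
      (𝓝[>] 0) (𝓝 (star x ⬝ᵥ (H.mulVec x))) := by
    have : Tendsto (fun r : ℝ => (r : ℂ) * (star x ⬝ᵥ x) + star x ⬝ᵥ (H.mulVec x))
      (𝓝 0) (𝓝 (((0 : ℝ) : ℂ) * (star x ⬝ᵥ x) + star x ⬝ᵥ (H.mulVec x))) :=
      (Continuous.tendsto (by fun_prop) 0)
    simpa using this.mono_left nhdsWithin_le_nhds
  exact ge_of_tendsto hlim (eventually_mem_nhdsWithin.mono fun r hr => hre r hr)

/-- The matrix algebra `M_ν(ℂ)` as an operator system: an element of `M_n(M_ν(ℂ))` is positive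
if it is positive semidefinite as a complex `nν × nν` matrix. -/
instance instOperatorSystemMatrix (ν : ℕ) : OperatorSystem (Matrix (Fin ν) (Fin ν) ℂ) where
  pos n := {A | (Matrix.comp (Fin n) (Fin n) (Fin ν) (Fin ν) ℂ A).PosSemidef}
  pos_isHermitian {n A} hA := by
    ext i j k l
    exact congrFun (congrFun hA.1 (i, k)) (j, l)
  pos_add {n A B} hA hB := Matrix.PosSemidef.add hA hB
  pos_smul {n A r} hr hA := Matrix.PosSemidef.smul (α := ℂ) hA (by exact_mod_cast hr)
  pos_proper {n A} hA hB := by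
    have h : Matrix.comp (Fin n) (Fin n) (Fin ν) (Fin ν) ℂ A = 0 :=
      matrix_proper hA hB
    exact (Matrix.comp (Fin n) (Fin n) (Fin ν) (Fin ν) ℂ).injective h
  pos_compress {n m} X {A} hA := by
    have h := Matrix.PosSemidef.conjTranspose_mul_mul_same hA
      (Matrix.of fun (p : Fin n × Fin ν) (q : Fin m × Fin ν) => if p.2 = q.2 then X p.1 q.1 else 0)
    show Matrix.PosSemidef _
    convert h using 1
    ext ⟨i, k⟩ ⟨j, l⟩
    simp [matCompress, Matrix.mul_apply, Fintype.sum_prod_type, Matrix.sum_apply,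
      Finset.sum_mul, apply_ite]
    rw [Finset.sum_comm]
    exact Finset.sum_congr rfl fun _ _ => Finset.sum_congr rfl fun _ _ => by ring
  star_one := by simp
  order_unit {n A} hA := by
    obtain ⟨r, hr, h⟩ := matrix_order_unit (H := Matrix.comp (Fin n) (Fin n) (Fin ν) (Fin ν) ℂ A)
      (by ext ⟨i, k⟩ ⟨j, l⟩; exact congrFun (congrFun (congrFun (congrFun hA i) j) k) l)
    refine ⟨r, hr, ?_⟩
    show Matrix.PosSemidef _
    rw [← Matrix.comp_one] at h
    exact h
  archimedean {n A} h := matrix_archimedean fun r hr => by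
    rw [← Matrix.comp_one]
    exact h r hr

end MatrixAlgebra

/-- `lim_{n ≫ m} f(n, m) = 0`, that is `lim_m limsup_n f(n, m) = 0`, for a nonnegative `f`. -/
def AsympZero {N : Type v} [Preorder N] (f : N → N → ℝ) : Prop :=
  ∀ ε : ℝ, 0 < ε → ∀ᶠ m in atTop, ∀ᶠ n in atTop, f n m < ε

theorem AsympZero.of_le_add {N : Type v} [Preorder N] {f g h : N → N → ℝ}
    (hf : AsympZero f) (hg : AsympZero g) (hle : ∀ n m, h n m ≤ f n m + g n m) : AsympZero h := by
  intro ε hε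
  filter_upwards [hf (ε / 2) (by positivity), hg (ε / 2) (by positivity)] with m h1 h2
  filter_upwards [h1, h2] with n h3 h4
  linarith [hle n m]

/-- A soft inductive system of operator systems over the directed set `N`: a family of operator
systems `S n` with ucp connecting maps `j n m : S m → S n` for `m < n` that are asymptotically
transitive. The connecting maps are extended to all pairs of indices by `j n n = id` and
`j n m = 0` if `m ≤ n` fails. -/
structure SoftInductiveSystem (N : Type v) [Preorder N] (S : N → Type w)
    [∀ n, OperatorSystem (S n)] where
  /-- the connecting map from `S m` to `S n` -/
  j : ∀ n m : N, S m →ₗ[ℂ] S n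
  ucp : ∀ {n m : N}, m ≤ n → IsUCP (j n m)
  refl : ∀ n : N, j n n = LinearMap.id
  not_le : ∀ {n m : N}, ¬ m ≤ n → j n m = 0
  asymp_trans : ∀ (l : N) (a : S l), AsympZero fun n m => ‖j n l a - j n m (j m l a)‖

namespace SoftInductiveSystem

/-- The space of uniformly bounded nets `a` with `lim_n ‖a n‖ = 0`. -/
def null {N : Type v} [Preorder N] (S : N → Type w) [∀ n, OperatorSystem (S n)] : Submodule ℂ (∀ n, S n) where
  carrier := {a | (∃ C : ℝ, ∀ n, ‖a n‖ ≤ C) ∧ Tendsto (fun n => ‖a n‖) atTop (𝓝 0)}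
  add_mem' := by
    rintro a b ⟨⟨C, hC⟩, ha⟩ ⟨⟨D, hD⟩, hb⟩
    refine ⟨⟨C + D, fun n => (norm_add_le _ _).trans (add_le_add (hC n) (hD n))⟩, ?_⟩
    exact squeeze_zero (fun n => norm_nonneg _) (fun n => norm_add_le (a n) (b n))
      (by simpa using ha.add hb)
  zero_mem' := ⟨⟨0, fun n => by simp⟩, by simpa using tendsto_const_nhds⟩
  smul_mem' := by
    rintro c a ⟨⟨C, hC⟩, ha⟩
    refine ⟨⟨‖c‖ * C, fun n => ?_⟩, ?_⟩
    · rw [Pi.smul_apply, norm_smul]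
      exact mul_le_mul_of_nonneg_left (hC n) (norm_nonneg c)
    · simpa [norm_smul] using ha.const_mul ‖c‖

theorem null_eventually {N : Type v} [Preorder N] {S : N → Type w}
    [∀ n, OperatorSystem (S n)] {a : ∀ n, S n} (ha : a ∈ null S) {ε : ℝ} (hε : 0 < ε) :
    ∀ᶠ n in atTop, ‖a n‖ < ε :=
  ha.2.eventually_lt_const hε

variable {N : Type v} [Preorder N] {S : N → Type w} [∀ n, OperatorSystem (S n)]
  (J : SoftInductiveSystem N S)

/-- A strict inductive system: the connecting maps are transitive. -/
def IsStrict : Prop :=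
  ∀ {l m n : N}, l ≤ m → m ≤ n → J.j n m ∘ₗ J.j m l = J.j n l

theorem norm_j_le (n m : N) (a : S m) : ‖J.j n m a‖ ≤ ‖a‖ := by
  by_cases h : m ≤ n
  · exact (J.ucp h).norm_map_le a
  · simp [J.not_le h]

theorem j_star (n m : N) (a : S m) : J.j n m (star a) = star (J.j n m a) := by
  by_cases h : m ≤ n
  · exact (J.ucp h).cp.map_star a
  · simp [J.not_le h]

/-- The space of uniformly bounded `j`-convergent nets. -/
def convergent : Submodule ℂ (∀ n, S n) where
  carrier := {a | (∃ C : ℝ, ∀ n, ‖a n‖ ≤ C) ∧ AsympZero fun n m => ‖a n - J.j n m (a m)‖}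
  add_mem' := by
    rintro a b ⟨⟨C, hC⟩, ha⟩ ⟨⟨D, hD⟩, hb⟩
    refine ⟨⟨C + D, fun n => (norm_add_le _ _).trans (add_le_add (hC n) (hD n))⟩,
      ha.of_le_add hb fun n m => ?_⟩
    have : (a + b) n - J.j n m ((a + b) m)
        = (a n - J.j n m (a m)) + (b n - J.j n m (b m)) := by
      simp only [Pi.add_apply, map_add]; abel
    rw [this]
    exact norm_add_le _ _
  zero_mem' := by
    refine ⟨⟨0, fun n => by simp⟩, fun ε hε => ?_⟩
    simp [hε]
  smul_mem' := by
    rintro c a ⟨⟨C, hC⟩, ha⟩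
    refine ⟨⟨‖c‖ * C, fun n => ?_⟩, fun ε hε => ?_⟩
    · rw [Pi.smul_apply, norm_smul]
      exact mul_le_mul_of_nonneg_left (hC n) (norm_nonneg c)
    · filter_upwards [ha (ε / (‖c‖ + 1)) (by positivity)] with m h1
      filter_upwards [h1] with n h2
      rw [Pi.smul_apply, Pi.smul_apply, map_smul, ← smul_sub, norm_smul]
      rw [lt_div_iff₀ (by positivity)] at h2
      nlinarith [norm_nonneg (a n - J.j n m (a m)), norm_nonneg c]

theorem null_le_convergent : null S ≤ J.convergent := by
  rintro a ha
  refine ⟨ha.1, fun ε hε => ?_⟩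
  have h := null_eventually ha (half_pos hε)
  filter_upwards [h] with m hm
  filter_upwards [h] with n hn
  linarith [norm_sub_le (a n) (J.j n m (a m)), J.norm_j_le n m (a m)]

theorem star_mem {a : ∀ n, S n} (ha : a ∈ J.convergent) :
    (fun n => star (a n)) ∈ J.convergent := by
  obtain ⟨⟨C, hC⟩, h⟩ := ha
  refine ⟨⟨C, fun n => (OperatorSystem.norm_star_le _).trans (hC n)⟩, fun ε hε => ?_⟩
  filter_upwards [h ε hε] with m h1
  filter_upwards [h1] with n h2
  rw [J.j_star, ← star_sub]
  exact (OperatorSystem.norm_star_le _).trans_lt h2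

theorem star_mem_null {a : ∀ n, S n} (ha : a ∈ null S) :
    (fun n => star (a n)) ∈ null S := by
  obtain ⟨⟨C, hC⟩, h⟩ := ha
  exact ⟨⟨C, fun n => (OperatorSystem.norm_star_le _).trans (hC n)⟩,
    squeeze_zero (fun n => norm_nonneg _) (fun n => OperatorSystem.norm_star_le _) h⟩

theorem norm_one_le (T : Type w) [OperatorSystem T] : ‖(1 : T)‖ ≤ 1 := by
  refine OperatorSystem.norm_le_of_block one_pos ?_
  convert OperatorSystem.pos_compress (Matrix.of fun (_ : Fin 1) (_ : Fin 2) => (1 : ℂ))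
    (OperatorSystem.one_mem (S := T) 1) using 1
  ext i j
  fin_cases i <;> fin_cases j <;>
    simp [OperatorSystem.block, matCompress, OperatorSystem.star_one]

theorem one_mem_convergent : (fun n => (1 : S n)) ∈ J.convergent := by
  refine ⟨⟨1, fun n => norm_one_le _⟩, fun ε hε => ?_⟩
  filter_upwards with m
  filter_upwards [eventually_ge_atTop m] with n hn
  simpa [(J.ucp hn).map_one] using hε

/-- The null nets as a subspace of the `j`-convergent nets. -/
def nullConvergent : Submodule ℂ J.convergent := (null S).comap J.convergent.subtype

/-- The limit space of a soft inductive system: `j`-convergent nets modulo null nets. -/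
def Limit : Type (max v w) := J.convergent ⧸ J.nullConvergent

instance : AddCommGroup J.Limit := inferInstanceAs (AddCommGroup (J.convergent ⧸ J.nullConvergent))
instance : Module ℂ J.Limit := inferInstanceAs (Module ℂ (J.convergent ⧸ J.nullConvergent))

/-- The quotient map `j-lim` from the `j`-convergent nets onto the limit space. -/
def lim : J.convergent →ₗ[ℂ] J.Limit := J.nullConvergent.mkQ

theorem lim_surjective : Function.Surjective J.lim := J.nullConvergent.mkQ_surjective

theorem lim_eq_zero_iff {a : J.convergent} : J.lim a = 0 ↔ a.1 ∈ null S :=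
  Submodule.Quotient.mk_eq_zero _

theorem lim_eq_iff {a b : J.convergent} : J.lim a = J.lim b ↔ (a - b).1 ∈ null S := by
  rw [← sub_eq_zero, ← map_sub, lim_eq_zero_iff]

/-- The entrywise adjoint of a `j`-convergent net. -/
def starNet (a : J.convergent) : J.convergent := ⟨fun n => star (a.1 n), J.star_mem a.2⟩

/-- The net of units. -/
def oneNet : J.convergent := ⟨fun _ => 1, J.one_mem_convergent⟩

instance : One J.Limit := ⟨J.lim J.oneNet⟩

instance : Star J.Limit :=
  ⟨Quotient.lift (fun a => J.lim (J.starNet a)) fun a b hab => by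
    refine J.lim_eq_iff.2 ?_
    have h : (a - b).1 ∈ null S := J.lim_eq_iff.1 (Quotient.sound hab)
    convert star_mem_null h using 2
    simp [starNet]⟩

theorem star_lim (a : J.convergent) : star (J.lim a) = J.lim (J.starNet a) := rfl

theorem one_def : (1 : J.Limit) = J.lim J.oneNet := rfl

instance : StarAddMonoid J.Limit where
  star_involutive x := by
    obtain ⟨a, rfl⟩ := J.lim_surjective x
    rw [star_lim, star_lim]
    congr 1
    ext n
    simp [starNet]
  star_add x y := by
    obtain ⟨a, rfl⟩ := J.lim_surjective x
    obtain ⟨b, rfl⟩ := J.lim_surjective y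
    rw [← map_add, star_lim, star_lim, star_lim, ← map_add]
    congr 1
    ext n
    simp [starNet]

instance : StarModule ℂ J.Limit where
  star_smul c x := by
    obtain ⟨a, rfl⟩ := J.lim_surjective x
    rw [← map_smul, star_lim, star_lim, ← map_smul]
    congr 1
    ext n
    simp [starNet]

/-- The `n`-th entry of a matrix of nets, a matrix over `S n`. -/
def entry {N : Type v} {S : N → Type w} [∀ n, OperatorSystem (S n)]
    {P : Submodule ℂ (∀ n, S n)} {k : ℕ} (a : Matrix (Fin k) (Fin k) P) (n : N) :
    Matrix (Fin k) (Fin k) (S n) :=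
  a.map fun x => x.1 n

/-- The positive cone of `M_k` of the limit space: the limits of those matrices `a` of
`j`-convergent nets such that for every `ε > 0` there is a matrix `b` of null nets
with `ε1 + a + b ≥ 0`. -/
def limitPos (k : ℕ) : Set (Matrix (Fin k) (Fin k) J.Limit) :=
  {A | ∃ a : Matrix (Fin k) (Fin k) J.convergent, a.map J.lim = A ∧
    ∀ ε : ℝ, 0 < ε → ∃ b : Matrix (Fin k) (Fin k) (null S), ∀ n,
      (ε : ℂ) • (1 : Matrix (Fin k) (Fin k) (S n)) + entry a n + entry b n
        ∈ OperatorSystem.pos k}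

theorem exists_lift {k : ℕ} (A : Matrix (Fin k) (Fin k) J.Limit) :
    ∃ a : Matrix (Fin k) (Fin k) J.convergent, a.map J.lim = A := by
  choose a ha using fun i l => J.lim_surjective (A i l)
  exact ⟨Matrix.of a, by ext i l; exact ha i l⟩

/-- Membership in the cone does not depend on the representative. -/
theorem map_lim_mem_limitPos {k : ℕ} {a : Matrix (Fin k) (Fin k) J.convergent} :
    a.map J.lim ∈ J.limitPos k ↔ ∀ ε : ℝ, 0 < ε → ∃ b : Matrix (Fin k) (Fin k) (null S), ∀ n,
      (ε : ℂ) • (1 : Matrix (Fin k) (Fin k) (S n)) + entry a n + entry b n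
        ∈ OperatorSystem.pos k := by
  refine ⟨?_, fun h => ⟨a, rfl, h⟩⟩
  rintro ⟨a', haa', h⟩ ε hε
  obtain ⟨b, hb⟩ := h ε hε
  have hd : ∀ i l, (a' i l - a i l).1 ∈ null S := fun i l =>
    J.lim_eq_iff.1 (congrFun (congrFun haa' i) l)
  refine ⟨Matrix.of fun i l => ⟨_, hd i l⟩ + b i l, fun n => ?_⟩
  convert hb n using 1
  ext i l
  simp [entry]
  abel

theorem entry_eventually_lt {k : ℕ} (b : Matrix (Fin k) (Fin k) (null S)) {ε : ℝ} (hε : 0 < ε) :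
    ∀ᶠ n in atTop, ∀ i l, ‖entry b n i l‖ < ε := by
  rw [eventually_all]
  intro i
  rw [eventually_all]
  exact fun l => null_eventually (b i l).2 hε

theorem entry_bounded {k : ℕ} (a : Matrix (Fin k) (Fin k) J.convergent) :
    ∃ C : ℝ, 0 < C ∧ ∀ n i l, ‖entry a n i l‖ < C := by
  choose C hC using fun i l => (a i l).2.1
  refine ⟨1 + ∑ i, ∑ l, |C i l|, by positivity, fun n i l => ?_⟩
  have h1 : |C i l| ≤ ∑ l, |C i l| :=
    Finset.single_le_sum (f := fun l => |C i l|) (fun _ _ => abs_nonneg _) (Finset.mem_univ l)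
  have h2 : ∑ l, |C i l| ≤ ∑ i, ∑ l, |C i l| :=
    Finset.single_le_sum (f := fun i => ∑ l, |C i l|)
      (fun _ _ => Finset.sum_nonneg fun _ _ => abs_nonneg _) (Finset.mem_univ i)
  calc ‖entry a n i l‖ ≤ C i l := hC i l n
    _ ≤ |C i l| := le_abs_self _
    _ < _ := by linarith

theorem limitPos_isHermitian {k : ℕ} {A : Matrix (Fin k) (Fin k) J.Limit}
    (hA : A ∈ J.limitPos k) : A.IsHermitian := by
  obtain ⟨a, rfl, h⟩ := hA
  obtain ⟨b, hb⟩ := h 1 one_pos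
  ext i l
  rw [Matrix.conjTranspose_apply, Matrix.map_apply, Matrix.map_apply, star_lim, lim_eq_iff]
  have hn : (fun n => (b i l).1 n - star ((b l i).1 n)) ∈ null S :=
    (null S).sub_mem (b i l).2 (star_mem_null (b l i).2)
  convert hn using 1
  ext n
  have h1 := ((OperatorSystem.pos_isHermitian (hb n)).sub
    ((OperatorSystem.one_isHermitian (S := S n) k).smul (k := ((1 : ℝ) : ℂ))
      (by simp [IsSelfAdjoint]))).apply i l
  have h2 : star ((a l i).1 n) + star ((b l i).1 n) = (a i l).1 n + (b i l).1 n := by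
    simpa [entry, add_assoc, -Complex.coe_smul] using h1
  simp only [starNet, Submodule.coe_sub, Pi.sub_apply]
  rw [sub_eq_sub_iff_add_eq_add, h2, add_comm]

theorem limitPos_proper {k : ℕ} {A : Matrix (Fin k) (Fin k) J.Limit}
    (hA : A ∈ J.limitPos k) (hA' : -A ∈ J.limitPos k) : A = 0 := by
  obtain ⟨a, rfl⟩ := J.exists_lift A
  have hneg : -(a.map J.lim) = (-a).map J.lim := by ext i l; simp
  rw [hneg] at hA'
  rw [map_lim_mem_limitPos] at hA hA'
  ext i l
  rw [Matrix.map_apply, Matrix.zero_apply, lim_eq_zero_iff]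
  refine ⟨(a i l).2.1, ?_⟩
  rw [Metric.tendsto_nhds]
  intro ε hε
  have hε' : 0 < ε / 4 := by positivity
  have hk : (0 : ℝ) < k := by exact_mod_cast i.pos
  obtain ⟨b, hb⟩ := hA (ε / 4) hε'
  obtain ⟨b', hb'⟩ := hA' (ε / 4) hε'
  filter_upwards [entry_eventually_lt b hε',
    entry_eventually_lt (b + b') (ε := ε / 4 / k) (by positivity)] with n h1 h2
  have hd : (-(entry (b + b') n)).IsHermitian := by
    have h3 := (((OperatorSystem.one_isHermitian (S := S n) k).smul (k := ((ε / 2 : ℝ) : ℂ))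
      (by simp [IsSelfAdjoint])).sub
      ((OperatorSystem.pos_isHermitian (hb n)).add (OperatorSystem.pos_isHermitian (hb' n))))
    convert h3 using 1
    have e1 : entry (b + b') n = entry b n + entry b' n := rfl
    have e2 : entry (-a) n = -entry a n := rfl
    rw [e1, e2]
    push_cast
    module
  have h4 := OperatorSystem.add_mem_of_norm_lt hd (δ := ε / 4 / k) fun p q => by
    rw [Matrix.neg_apply, norm_neg]; exact h2 p q
  rw [mul_div_cancel₀ _ hk.ne'] at h4
  have h5 := OperatorSystem.norm_apply_le (c := entry a n + entry b n) (r := ε / 2) (by positivity)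
    (by
      rw [← add_assoc, add_assoc]
      refine OperatorSystem.smul_one_add_mono (r := ε / 4) (by linarith) ?_
      rw [← add_assoc]
      exact hb n)
    (by
      convert OperatorSystem.pos_add h4 (hb' n) using 1
      have e1 : entry (b + b') n = entry b n + entry b' n := rfl
      have e2 : entry (-a) n = -entry a n := rfl
      rw [e1, e2]
      push_cast
      module) i l
  have h6 : ‖entry a n i l‖ ≤ ‖(entry a n + entry b n) i l‖ + ‖entry b n i l‖ := by
    have := norm_sub_le ((entry a n + entry b n) i l) (entry b n i l)
    simpa using this
  have h7 : ‖(a i l).1 n‖ < ε := by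
    have := h1 i l
    change ‖entry a n i l‖ < ε
    linarith
  simpa using h7

theorem entry_compress {N : Type v} {S : N → Type w} [∀ n, OperatorSystem (S n)]
    {P : Submodule ℂ (∀ n, S n)} {k m : ℕ} (X : Matrix (Fin k) (Fin m) ℂ)
    (a : Matrix (Fin k) (Fin k) P) (n : N) :
    entry (matCompress X a) n = matCompress X (entry a n) := by
  ext i l
  simp [entry, matCompress]

theorem matCompress_one {T : Type w} [OperatorSystem T] {k m : ℕ} (X : Matrix (Fin k) (Fin m) ℂ)
    (i l : Fin m) :
    matCompress X (1 : Matrix (Fin k) (Fin k) T) i l = (X.conjTranspose * X) i l • (1 : T) := by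
  simp [matCompress, Matrix.one_apply, Matrix.mul_apply, Finset.sum_smul]

open scoped Matrix.Norms.L2Operator MatrixOrder in
theorem exists_conjTranspose_mul_self {n : Type*} [Fintype n] [DecidableEq n] {H : Matrix n n ℂ}
    (hH : H.PosSemidef) : ∃ Y : Matrix n n ℂ, H = Y.conjTranspose * Y :=
  CStarAlgebra.nonneg_iff_eq_star_mul_self.1 (Matrix.nonneg_iff_posSemidef.2 hH)

theorem limitPos_compress {k m : ℕ} (X : Matrix (Fin k) (Fin m) ℂ)
    {A : Matrix (Fin k) (Fin k) J.Limit} (hA : A ∈ J.limitPos k) :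
    matCompress X A ∈ J.limitPos m := by
  obtain ⟨a, rfl⟩ := J.exists_lift A
  have e : matCompress X (a.map J.lim) = (matCompress X a).map J.lim := by
    ext i l
    simp [matCompress]
  rw [e]
  rw [map_lim_mem_limitPos] at hA ⊢
  intro ε hε
  obtain ⟨r, hr, hY⟩ := matrix_order_unit (H := -(X.conjTranspose * X))
    (Matrix.isHermitian_conjTranspose_mul_self X).neg
  obtain ⟨Y, hY⟩ := exists_conjTranspose_mul_self hY
  obtain ⟨b, hb⟩ := hA (ε / r) (by positivity)
  refine ⟨matCompress X b, fun n => ?_⟩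
  have h1 := OperatorSystem.pos_compress X (hb n)
  have h2 := OperatorSystem.pos_smul (r := ε / r) (by positivity)
    (OperatorSystem.pos_compress Y (OperatorSystem.one_mem (S := S n) m))
  convert OperatorSystem.pos_add h1 h2 using 1
  ext i l
  have h3 : (matCompress Y (1 : Matrix (Fin m) (Fin m) (S n))) i l
      = (r : ℂ) • (1 : Matrix (Fin m) (Fin m) (S n)) i l
        - (matCompress X (1 : Matrix (Fin k) (Fin k) (S n))) i l := by
    rw [matCompress_one, matCompress_one, ← hY]
    by_cases hil : i = l
    · subst hil
      simp [-Complex.coe_smul]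
      module
    · simp [hil]
  have h4 : (((ε / r : ℝ) : ℂ) * (r : ℂ)) = (ε : ℂ) := by
    rw [← Complex.ofReal_mul, div_mul_cancel₀ _ hr.ne']
  have h5 : ∀ A B C : Matrix (Fin k) (Fin k) (S n), (matCompress X (((ε / r : ℝ) : ℂ) • A + B + C)) i l
      = ((ε / r : ℝ) : ℂ) • (matCompress X A) i l + (matCompress X B) i l
        + (matCompress X C) i l := by
    intro A B C
    simp only [matCompress, Matrix.of_apply, Matrix.add_apply, Matrix.smul_apply, smul_add,
      Finset.sum_add_distrib, Finset.smul_sum]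
    simp only [smul_comm (((ε / r : ℝ) : ℂ))]
  rw [Matrix.add_apply _ (((ε / r : ℝ) : ℂ) • _), Matrix.smul_apply, h3, h5, smul_sub, smul_smul,
    h4, entry_compress, entry_compress, Matrix.add_apply, Matrix.add_apply, Matrix.smul_apply]
  abel

theorem smul_one_add_mem_limitPos {k : ℕ} {a : Matrix (Fin k) (Fin k) J.convergent} {r : ℝ} :
    (r : ℂ) • (1 : Matrix (Fin k) (Fin k) J.Limit) + a.map J.lim ∈ J.limitPos k ↔
      ∀ ε : ℝ, 0 < ε → ∃ b : Matrix (Fin k) (Fin k) (null S), ∀ n,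
        (ε : ℂ) • (1 : Matrix (Fin k) (Fin k) (S n))
          + ((r : ℂ) • (1 : Matrix (Fin k) (Fin k) (S n)) + entry a n) + entry b n
          ∈ OperatorSystem.pos k := by
  have e : (r : ℂ) • (1 : Matrix (Fin k) (Fin k) J.Limit) + a.map J.lim
      = ((r : ℂ) • (Matrix.diagonal fun _ => J.oneNet) + a).map J.lim := by
    ext i l
    by_cases h : i = l
    · subst h; simp [one_def, -Complex.coe_smul]
    · simp [h]
  have e2 : ∀ n, entry ((r : ℂ) • (Matrix.diagonal fun _ => J.oneNet) + a) n
      = (r : ℂ) • (1 : Matrix (Fin k) (Fin k) (S n)) + entry a n := by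
    intro n
    ext i l
    by_cases h : i = l
    · subst h; simp [entry, oneNet, -Complex.coe_smul]
    · simp [entry, h]
  rw [e, map_lim_mem_limitPos]
  simp only [e2]

theorem limit_order_unit {k : ℕ} {A : Matrix (Fin k) (Fin k) J.Limit} (hA : A.IsHermitian) :
    ∃ r : ℝ, 0 < r ∧ (r : ℂ) • (1 : Matrix (Fin k) (Fin k) J.Limit) + A ∈ J.limitPos k := by
  have hh : star (1 / 2 : ℂ) = 1 / 2 := by simp
  obtain ⟨a₀, ha₀⟩ := J.exists_lift A
  obtain ⟨a, ha, hs⟩ : ∃ a : Matrix (Fin k) (Fin k) J.convergent, a.map J.lim = A ∧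
      ∀ n, (entry a n).IsHermitian := by
    refine ⟨Matrix.of fun i l => (1 / 2 : ℂ) • (a₀ i l + J.starNet (a₀ l i)), ?_, fun n => ?_⟩
    · ext i l
      have h1 : J.lim (a₀ i l) = A i l := congrFun (congrFun ha₀ i) l
      have h2 : J.lim (a₀ l i) = A l i := congrFun (congrFun ha₀ l) i
      rw [Matrix.map_apply, Matrix.of_apply, map_smul, map_add, ← star_lim, h1, h2, hA.apply i l]
      module
    · ext i l
      simp only [entry, starNet, Matrix.conjTranspose_apply, Matrix.map_apply, Matrix.of_apply,
        Submodule.coe_smul, Submodule.coe_add, Pi.smul_apply, Pi.add_apply, star_smul, star_add,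
        star_star, hh]
      rw [add_comm]
  obtain ⟨C, hC, hb⟩ := J.entry_bounded a
  refine ⟨k * C + 1, by positivity, ?_⟩
  rw [← ha, smul_one_add_mem_limitPos]
  intro ε hε
  refine ⟨0, fun n => ?_⟩
  have e0 : entry (0 : Matrix (Fin k) (Fin k) (null S)) n = 0 := rfl
  rw [e0, add_zero, ← add_assoc, ← add_smul, ← Complex.ofReal_add]
  exact OperatorSystem.smul_one_add_mono (by linarith)
    (OperatorSystem.add_mem_of_norm_lt (hs n) (hb n))

/-- The limit space of a soft inductive system of operator systems is an operator system. -/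
instance : OperatorSystem J.Limit where
  pos := J.limitPos
  pos_isHermitian := J.limitPos_isHermitian
  pos_add {k A B} hA hB := by
    obtain ⟨a, rfl⟩ := J.exists_lift A
    obtain ⟨b, rfl⟩ := J.exists_lift B
    have e : a.map J.lim + b.map J.lim = (a + b).map J.lim := by ext i l; simp
    rw [e]
    rw [map_lim_mem_limitPos] at hA hB ⊢
    intro ε hε
    obtain ⟨c, hc⟩ := hA (ε / 2) (half_pos hε)
    obtain ⟨d, hd⟩ := hB (ε / 2) (half_pos hε)
    refine ⟨c + d, fun n => ?_⟩
    convert OperatorSystem.pos_add (hc n) (hd n) using 1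
    have h1 : entry (a + b) n = entry a n + entry b n := rfl
    have h2 : entry (c + d) n = entry c n + entry d n := rfl
    rw [h1, h2]
    push_cast
    module
  pos_smul {k A r} hr hA := by
    obtain ⟨a, rfl⟩ := J.exists_lift A
    have e : (r : ℂ) • a.map J.lim = ((r : ℂ) • a).map J.lim := by ext i l; simp
    rw [e]
    rw [map_lim_mem_limitPos] at hA ⊢
    intro ε hε
    obtain ⟨c, hc⟩ := hA (ε / (r + 1)) (by positivity)
    refine ⟨(r : ℂ) • c, fun n => ?_⟩
    have h := OperatorSystem.smul_one_add_mono (r := r * (ε / (r + 1))) (s := ε)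
      (A := (r : ℂ) • (entry a n + entry c n)) (by
        rw [mul_div_assoc', div_le_iff₀ (by positivity)]; nlinarith)
      (by
        convert OperatorSystem.pos_smul hr (hc n) using 1
        push_cast
        module)
    convert h using 1
    have h1 : entry ((r : ℂ) • a) n = (r : ℂ) • entry a n := rfl
    have h2 : entry ((r : ℂ) • c) n = (r : ℂ) • entry c n := rfl
    rw [h1, h2]
    module
  pos_proper := J.limitPos_proper
  pos_compress X _ hA := J.limitPos_compress X hA
  star_one := by
    rw [one_def, star_lim]
    congr 1
    ext n
    exact OperatorSystem.star_one
  order_unit := J.limit_order_unit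
  archimedean {k A} h := by
    obtain ⟨a, rfl⟩ := J.exists_lift A
    rw [map_lim_mem_limitPos]
    intro ε hε
    obtain ⟨b, hb⟩ := (J.smul_one_add_mem_limitPos.1 (h (ε / 2) (half_pos hε))) (ε / 2)
      (half_pos hε)
    refine ⟨b, fun n => ?_⟩
    convert hb n using 1
    push_cast
    module

end SoftInductiveSystem

namespace SoftInductiveSystem

/-- A soft inductive system is split if `j-lim` has a right inverse `s` that is a linear
contraction from the limit space into the `j`-convergent nets (with the supremum norm) and, as
befits operator systems, is unital and completely positive, i.e. has ucp components. -/
def IsSplit {N : Type v} [Preorder N] {S : N → Type w} [∀ n, OperatorSystem (S n)]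
    (J : SoftInductiveSystem N S) : Prop :=
  ∃ s : J.Limit →ₗ[ℂ] J.convergent,
    (∀ x n, ‖(s x).1 n‖ ≤ ‖x‖) ∧
    (∀ n, IsUCP (LinearMap.proj n ∘ₗ J.convergent.subtype ∘ₗ s)) ∧
    ∀ x, J.lim (s x) = x

end SoftInductiveSystem

/-- Nuclearity of an operator system: the identity is a point-norm limit of a net of maps that
factor through matrix algebras by completely positive contractions. -/
def IsNuclear (S : Type u) [OperatorSystem S] : Prop :=
  ∃ (I : Type u) (_ : Preorder I) (_ : IsDirectedOrder I) (_ : Nonempty I) (ν : I → ℕ)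
    (ψ : ∀ i, S →ₗ[ℂ] Matrix (Fin (ν i)) (Fin (ν i)) ℂ)
    (φ : ∀ i, Matrix (Fin (ν i)) (Fin (ν i)) ℂ →ₗ[ℂ] S),
    (∀ i, IsCPC (ψ i)) ∧ (∀ i, IsCPC (φ i)) ∧
    ∀ a : S, Tendsto (fun i => φ i (ψ i a)) atTop (𝓝 a)

/-- A soft inductive system of full matrix algebras `M_ν(ℂ)`. -/
abbrev SoftMatrixSystem (N : Type v) [Preorder N] (ν : N → ℕ) :=
  SoftInductiveSystem N fun n => Matrix (Fin (ν n)) (Fin (ν n)) ℂ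

/-- The operator system `S` is the limit of the soft inductive system `J`, up to completion: there
is a unital complete order embedding of `S` into the limit space with dense range; it is a
complete order isomorphism if `S` is norm complete. -/
def IsLimitOf (S : Type u) [OperatorSystem S] {N : Type v} [Preorder N] {T : N → Type w}
    [∀ n, OperatorSystem (T n)] (J : SoftInductiveSystem N T) : Prop :=
  ∃ f : S →ₗ[ℂ] J.Limit, IsCompleteOrderEmbedding f ∧ DenseRange f ∧
    (CompleteSpace S → IsCompleteOrderIso f)

/-! A nuclear operator system has approximate factorizations of its identity through matrix algebras
by cp contractions `ψ`, `φ`. Adding `ω(·)(1 - ψ 1)` and `τ(·)(1 - φ 1)` with states `ω`, `τ` makes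
both maps unital. The errors are small because `φ (1 - ψ 1)` and `1 - φ 1` are positive with sum `1
- φ (ψ 1)` (`exists_ucp_of_cpc`).

Let ucp maps `σ n : S → T n`, `ρ n : T n → S` satisfy `ρ n ∘ σ n → id` pointwise. With connecting
maps `σ n ∘ ρ m`, the defect of transitivity is `σ n (id - ρ m ∘ σ m) ρ l`, which is asymptotically
zero. For separable `S` each pair is chosen after its predecessor, so that `ρ (n+1) ∘ σ (n+1)` is
within `2⁻ⁿ` of the identity on the unit ball of the range of `ρ n`; this range is
finite-dimensional, so finitely many vectors control it. The compositions of the one-step maps `σ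
(n+1) ∘ ρ n` then form a strict system that stays uniformly close to `σ n ∘ ρ m`.

Both cases are instances of `Approximation`, from which the limit is identified once. The map `a ↦
j-lim σ n a` preserves positivity, and reflects it since `ρ n` carries positivity back to `S`, where
cones are closed. Its range is dense because `σ n (ρ m (x m))` is close to `x n` for `n ≫ m`. The
splitting extends each `σ n` continuously to the limit space. -/

namespace OperatorSystem

/-! ### Closedness of the cones and order estimates for the norm -/

variable {S : Type u} {T : Type v} [OperatorSystem S] [OperatorSystem T]

theorem map_add_map {k : ℕ} (f : S →ₗ[ℂ] T) (A B : Matrix (Fin k) (Fin k) S) :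
    (A + B).map f = A.map f + B.map f := by
  ext i l; simp

theorem map_smul_map {k : ℕ} (f : S →ₗ[ℂ] T) (c : ℂ) (A : Matrix (Fin k) (Fin k) S) :
    (c • A).map f = c • A.map f := by
  ext i l; simp

theorem map_one_map {k : ℕ} {f : S →ₗ[ℂ] T} (hf : f 1 = 1) :
    (1 : Matrix (Fin k) (Fin k) S).map f = 1 :=
  Matrix.map_one f (map_zero f) hf

/-- The cones of an operator system are closed in the topology of entrywise convergence. -/
theorem mem_of_tendsto {ι : Type*} {l : Filter ι} [l.NeBot] {k : ℕ}
    {A : ι → Matrix (Fin k) (Fin k) S} {B : Matrix (Fin k) (Fin k) S}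
    (hA : ∀ᶠ i in l, A i ∈ pos k)
    (h : ∀ p q, Tendsto (fun i => A i p q) l (𝓝 (B p q))) : B ∈ pos k := by
  have hB : B.IsHermitian := by
    ext p q
    have h1 : Tendsto (fun i => star (A i q p)) l (𝓝 (star (B q p))) := by
      rw [tendsto_iff_norm_sub_tendsto_zero]
      refine squeeze_zero (fun _ => norm_nonneg _) (fun i => ?_)
        (tendsto_iff_norm_sub_tendsto_zero.1 (h q p))
      rw [← star_sub]
      exact norm_star_le _
    refine tendsto_nhds_unique h1 ((h p q).congr' ?_)
    filter_upwards [hA] with i hi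
    exact ((pos_isHermitian hi).apply p q).symm
  refine archimedean fun r hr => ?_
  -- Entrywise errors below `δ` cost at most `kδ` times the unit, and `kδ ≤ r`; `k + 1` also covers
  -- `k = 0`.
  have hδ : 0 < r / (k + 1) := by positivity
  have h2 : ∀ᶠ i in l, ∀ p q, ‖(B - A i) p q‖ < r / (k + 1) := by
    rw [eventually_all]; intro p
    rw [eventually_all]; intro q
    have := (tendsto_iff_norm_sub_tendsto_zero.1 (h p q)).eventually_lt_const hδ
    filter_upwards [this] with i hi
    rwa [Matrix.sub_apply, norm_sub_rev]
  obtain ⟨i, h3, h4⟩ := (h2.and hA).exists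
  have h5 := pos_add (add_mem_of_norm_lt (hB.sub (pos_isHermitian h4)) h3) h4
  rw [add_assoc, sub_add_cancel] at h5
  refine smul_one_add_mono ?_ h5
  rw [mul_div_assoc', div_le_iff₀ (by positivity)]
  nlinarith

/-- The `1 × 1` matrix with entry `a`. -/
def mat1 (a : S) : Matrix (Fin 1) (Fin 1) S := Matrix.of fun _ _ => a

theorem mat1_one_mem : mat1 (1 : S) ∈ pos 1 := by
  convert one_mem (S := S) 1 using 1
  ext i j
  obtain rfl := Subsingleton.elim i j
  simp [mat1]

/-- For self-adjoint `a`, compressing `block (r + t) a` by the column `(1, -1)` gives `2(r + t -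
a)`; the Archimedean property removes `t`. -/
theorem smul_one_sub_mat1_mem {a : S} (ha : star a = a) {r : ℝ} (h : ‖a‖ ≤ r) :
    mat1 ((r : ℂ) • (1 : S) - a) ∈ pos 1 := by
  refine archimedean fun t ht => ?_
  have h1 := pos_smul (r := 1 / 2) (by norm_num)
    (pos_compress (Matrix.of fun (i : Fin 2) (_ : Fin 1) => ![(1 : ℂ), -1] i)
      (block_mem_of_norm_lt (a := a) (r := r + t) (by linarith)))
  convert h1 using 1
  ext i j
  obtain rfl := Subsingleton.elim i 0
  obtain rfl := Subsingleton.elim j 0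
  simp [matCompress, Fin.sum_univ_two, block, mat1, ha, -Complex.coe_smul]
  module

/-- From `0 ≤ a ≤ b ≤ ‖b‖ + ε` the element `a` lies between `±(‖b‖ + ε)`. This monotonicity bounds
the correction terms in the unitization. -/
theorem norm_le_of_mat1_mem {a b : S} (ha : mat1 a ∈ pos 1) (hb : mat1 (b - a) ∈ pos 1) :
    ‖a‖ ≤ ‖b‖ := by
  have h0 := pos_add ha hb
  have hb' : star b = b := by
    have := (pos_isHermitian h0).apply 0 0
    simpa [mat1] using this
  refine le_of_forall_pos_le_add fun ε hε => ?_
  have hr : (0 : ℝ) < ‖b‖ + ε := by positivity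
  refine norm_apply_le (c := mat1 a) hr (pos_add (pos_smul hr.le (one_mem 1)) ha) ?_ 0 0
  have h1 := pos_add (smul_one_sub_mat1_mem hb' (r := ‖b‖ + ε) (by linarith)) hb
  convert h1 using 1
  ext i j
  obtain rfl := Subsingleton.elim i 0
  obtain rfl := Subsingleton.elim j 0
  simp [mat1, -Complex.coe_smul]

end OperatorSystem

/-! ### Completely positive maps and functionals -/

section Maps

variable {S : Type u} {T : Type v} [OperatorSystem S] [OperatorSystem T]

theorem IsCompletelyPositive.mat1_mem {f : S →ₗ[ℂ] T} (hf : IsCompletelyPositive f) {a : S}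
    (ha : OperatorSystem.mat1 a ∈ OperatorSystem.pos 1) :
    OperatorSystem.mat1 (f a) ∈ OperatorSystem.pos 1 :=
  hf 1 _ ha

theorem IsCompletelyPositive.add {f g : S →ₗ[ℂ] T} (hf : IsCompletelyPositive f)
    (hg : IsCompletelyPositive g) : IsCompletelyPositive (f + g) := fun n A hA => by
  have h := OperatorSystem.pos_add (hf n A hA) (hg n A hA)
  convert h using 1
  ext i j
  rfl

theorem IsCompletelyPositive.comp {R : Type w} [OperatorSystem R] {g : T →ₗ[ℂ] R}
    {f : S →ₗ[ℂ] T} (hg : IsCompletelyPositive g) (hf : IsCompletelyPositive f) :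
    IsCompletelyPositive (g ∘ₗ f) := fun n A hA => hg n _ (hf n A hA)

theorem IsUCP.comp {R : Type w} [OperatorSystem R] {g : T →ₗ[ℂ] R}
    {f : S →ₗ[ℂ] T} (hg : IsUCP g) (hf : IsUCP f) : IsUCP (g ∘ₗ f) :=
  ⟨by simp [hf.map_one, hg.map_one], hg.cp.comp hf.cp⟩

theorem IsUCP.id : IsUCP (LinearMap.id : S →ₗ[ℂ] S) := ⟨rfl, fun n A hA => by simpa using hA⟩

/-- Completely positive functionals. -/
def IsCPFunctional (ω : S →ₗ[ℂ] ℂ) : Prop :=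
  ∀ (n : ℕ) (A : Matrix (Fin n) (Fin n) S), A ∈ OperatorSystem.pos n → (A.map ω).PosSemidef

/-- Writing `A.map ω` as `Y⋆ Y` displays its product with `t` as the sum of the compressions of `t`
by the rows of `Y`. -/
theorem IsCPFunctional.smulRight {ω : S →ₗ[ℂ] ℂ} (hω : IsCPFunctional ω) {t : T}
    (ht : OperatorSystem.mat1 t ∈ OperatorSystem.pos 1) :
    IsCompletelyPositive (ω.smulRight t) := fun n A hA => by
  obtain ⟨Y, hY⟩ := SoftInductiveSystem.exists_conjTranspose_mul_self (hω n A hA)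
  have h := OperatorSystem.sum_mem Finset.univ _ fun k _ =>
    OperatorSystem.pos_compress (Matrix.of fun (_ : Fin 1) (j : Fin n) => Y k j) ht
  convert h using 1
  ext i j
  have h1 := congrFun (congrFun hY i) j
  rw [Matrix.map_apply, Matrix.mul_apply] at h1
  rw [Matrix.sum_apply]
  simp [h1, matCompress, OperatorSystem.mat1, Finset.sum_smul]

/-- The map `a ↦ ω(a) 1` is ucp, hence contractive. Keeping the factor `‖1‖` avoids computing it and
allows `T = 0`. -/
theorem IsCPFunctional.norm_apply_mul_le {ω : S →ₗ[ℂ] ℂ} (hω : IsCPFunctional ω) (h1 : ω 1 = 1)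
    (a : S) : ‖ω a‖ * ‖(1 : T)‖ ≤ ‖a‖ := by
  have h : IsUCP (ω.smulRight (1 : T)) :=
    ⟨by simp [h1], hω.smulRight OperatorSystem.mat1_one_mem⟩
  simpa [norm_smul] using h.norm_map_le a

theorem IsCompletelyPositive.diag_isCPFunctional {ν : ℕ}
    {ψ : S →ₗ[ℂ] Matrix (Fin ν) (Fin ν) ℂ} (hψ : IsCompletelyPositive ψ) (k : Fin ν) :
    IsCPFunctional (Matrix.entryLinearMap ℂ ℂ k k ∘ₗ ψ) := fun n A hA =>
  (hψ n A hA).submatrix fun i => (i, k)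

theorem mat1_posSemidef {ν : ℕ} {x : Matrix (Fin ν) (Fin ν) ℂ}
    (hx : OperatorSystem.mat1 x ∈ OperatorSystem.pos 1) : x.PosSemidef :=
  hx.submatrix fun i => (0, i)

/-- A completely positive map into a matrix algebra that does not annihilate the unit has a
diagonal entry that is a multiple of a state. -/
theorem IsCompletelyPositive.exists_state {ν : ℕ} {ψ : S →ₗ[ℂ] Matrix (Fin ν) (Fin ν) ℂ}
    (hψ : IsCompletelyPositive ψ) (h : ψ 1 ≠ 0) :
    ∃ ω : S →ₗ[ℂ] ℂ, IsCPFunctional ω ∧ ω 1 = 1 := by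
  have h1 : (ψ 1).PosSemidef := mat1_posSemidef (hψ.mat1_mem OperatorSystem.mat1_one_mem)
  have h2 : (ψ 1).trace ≠ 0 := fun h0 => h (h1.trace_eq_zero_iff.1 h0)
  obtain ⟨k, -, hk⟩ := Finset.exists_ne_zero_of_sum_ne_zero h2
  refine ⟨(ψ 1 k k)⁻¹ • (Matrix.entryLinearMap ℂ ℂ k k ∘ₗ ψ), fun n A hA => ?_, ?_⟩
  · have h3 : (0 : ℂ) ≤ (ψ 1 k k)⁻¹ := inv_nonneg.2 h1.diag_nonneg
    exact (hψ.diag_isCPFunctional k n A hA).smul h3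
  · exact inv_mul_cancel₀ hk

end Maps

/-! ### From cp contractions to ucp factorizations -/

section Unitization

variable {S : Type u} [OperatorSystem S]

theorem IsCPC.mat1_one_sub_mem {T : Type v} [OperatorSystem T] {f : S →ₗ[ℂ] T} (hf : IsCPC f) :
    OperatorSystem.mat1 (1 - f 1) ∈ OperatorSystem.pos 1 := by
  have h1 : star (f 1) = f 1 := by rw [← hf.cp.map_star, OperatorSystem.star_one]
  have h2 : ‖f 1‖ ≤ 1 := (hf.contractive 1).trans (SoftInductiveSystem.norm_one_le S)
  simpa using OperatorSystem.smul_one_sub_mat1_mem h1 h2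

/-- Perturbing a pair of completely positive contractions to a pair of ucp maps. -/
theorem exists_ucp_of_cpc {ν : ℕ} {ψ : S →ₗ[ℂ] Matrix (Fin ν) (Fin ν) ℂ}
    {φ : Matrix (Fin ν) (Fin ν) ℂ →ₗ[ℂ] S} (hψ : IsCPC ψ) (hφ : IsCPC φ)
    (h : ‖φ (ψ 1) - 1‖ < ‖(1 : S)‖) :
    0 < ν ∧ ∃ (σ : S →ₗ[ℂ] Matrix (Fin ν) (Fin ν) ℂ) (ρ : Matrix (Fin ν) (Fin ν) ℂ →ₗ[ℂ] S),
      IsUCP σ ∧ IsUCP ρ ∧ ∀ a, ‖ρ (σ a) - a‖ * ‖(1 : S)‖ ≤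
        ‖φ (ψ a) - a‖ * ‖(1 : S)‖ + 2 * ‖a‖ * ‖φ (ψ 1) - 1‖ := by
  -- Otherwise the left side of `h` would equal `‖1‖`. This supplies a state on `S` and excludes `ν
  -- = 0`.
  have hψ1 : ψ 1 ≠ 0 := by
    intro h0
    rw [h0, map_zero, zero_sub, norm_neg] at h
    exact h.false
  obtain ⟨ω, hω, hω1⟩ := hψ.cp.exists_state hψ1
  have hν : 0 < ν := by
    rcases Nat.eq_zero_or_pos ν with rfl | h0
    · exact absurd (Subsingleton.elim _ _) hψ1
    · exact h0
  set τ : Matrix (Fin ν) (Fin ν) ℂ →ₗ[ℂ] ℂ :=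
    Matrix.entryLinearMap ℂ ℂ ⟨0, hν⟩ ⟨0, hν⟩ ∘ₗ LinearMap.id with hτdef
  have hτ : IsCPFunctional τ := IsUCP.id.cp.diag_isCPFunctional _
  have hτ1 : τ 1 = 1 := Matrix.one_apply_eq (⟨0, hν⟩ : Fin ν)
  have hσ : IsUCP (ψ + ω.smulRight (1 - ψ 1)) :=
    ⟨by simp [hω1], hψ.cp.add (hω.smulRight hψ.mat1_one_sub_mem)⟩
  have hρ : IsUCP (φ + τ.smulRight (1 - φ 1)) :=
    ⟨by simp [hτ1], hφ.cp.add (hτ.smulRight hφ.mat1_one_sub_mem)⟩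
  have hc := hφ.cp.mat1_mem hψ.mat1_one_sub_mem
  have hd := hφ.mat1_one_sub_mem
  -- Two positive elements with sum `1 - φ (ψ 1)`: each is dominated by the sum, hence also in norm.
  have e1 : (1 : S) - φ (ψ 1) - φ (1 - ψ 1) = 1 - φ 1 := by rw [map_sub]; abel
  have e2 : (1 : S) - φ (ψ 1) - (1 - φ 1) = φ (1 - ψ 1) := by rw [map_sub]; abel
  have hc' : ‖φ (1 - ψ 1)‖ ≤ ‖φ (ψ 1) - 1‖ := by
    rw [norm_sub_rev]
    exact OperatorSystem.norm_le_of_mat1_mem hc (e1 ▸ hd)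
  have hd' : ‖1 - φ 1‖ ≤ ‖φ (ψ 1) - 1‖ := by
    rw [norm_sub_rev _ (1 : S)]
    exact OperatorSystem.norm_le_of_mat1_mem hd (e2 ▸ hc)
  refine ⟨hν, _, _, hσ, hρ, fun a => ?_⟩
  set b := (ψ + ω.smulRight (1 - ψ 1)) a with hb
  have h1 : (φ + τ.smulRight (1 - φ 1)) b - a
      = (φ (ψ a) - a) + ω a • φ (1 - ψ 1) + τ b • (1 - φ 1) := by
    simp only [LinearMap.add_apply, LinearMap.smulRight_apply]
    rw [hb, LinearMap.add_apply, LinearMap.smulRight_apply, map_add, map_smul]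
    abel
  have h2 : ‖ω a‖ * ‖(1 : S)‖ ≤ ‖a‖ := hω.norm_apply_mul_le hω1 a
  have h3 : ‖τ b‖ * ‖(1 : S)‖ ≤ ‖a‖ := (hτ.norm_apply_mul_le hτ1 b).trans (hσ.norm_map_le a)
  rw [h1]
  calc _ ≤ (‖φ (ψ a) - a‖ + ‖ω a‖ * ‖φ (1 - ψ 1)‖ + ‖τ b‖ * ‖1 - φ 1‖) * ‖(1 : S)‖ := by
        gcongr
        refine (norm_add₃_le).trans ?_
        rw [norm_smul, norm_smul]
    _ = ‖φ (ψ a) - a‖ * ‖(1 : S)‖ + (‖ω a‖ * ‖(1 : S)‖) * ‖φ (1 - ψ 1)‖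
        + (‖τ b‖ * ‖(1 : S)‖) * ‖1 - φ 1‖ := by ring
    _ ≤ ‖φ (ψ a) - a‖ * ‖(1 : S)‖ + ‖a‖ * ‖φ (ψ 1) - 1‖ + ‖a‖ * ‖φ (ψ 1) - 1‖ := by gcongr
    _ = _ := by ring

/-- If `1 = 0`, then `block r a` does not depend on `r`, so every norm vanishes. -/
theorem OperatorSystem.norm_one_pos [Nontrivial S] : 0 < ‖(1 : S)‖ := by
  refine norm_pos_iff.2 fun h0 => ?_
  obtain ⟨a, ha⟩ := exists_ne (0 : S)
  refine ha ?_
  have hone : ∀ k, (1 : Matrix (Fin k) (Fin k) S) = 0 := fun k => by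
    ext i j
    simp [Matrix.one_apply, h0]
  have h1 : block 0 a ∈ pos 2 := by
    have := block_mem_of_norm_lt (lt_add_one ‖a‖)
    rwa [block_eq, hone, smul_zero, zero_add] at this
  exact norm_eq_zero.1 (le_antisymm (le_of_forall_pos_le_add fun ε hε => by
    rw [zero_add]
    exact norm_le_of_block hε (block_mono hε.le h1)) (norm_nonneg a))

/-- A pair of ucp maps that factor an approximation of the identity through a matrix algebra. -/
structure UCPFactorization (S : Type u) [OperatorSystem S] where
  ν : ℕ
  ν_pos : 0 < ν
  σ : S →ₗ[ℂ] Matrix (Fin ν) (Fin ν) ℂ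
  ρ : Matrix (Fin ν) (Fin ν) ℂ →ₗ[ℂ] S
  ucp_σ : IsUCP σ
  ucp_ρ : IsUCP ρ

theorem IsNuclear.exists_ucpFactorization [Nontrivial S] (hS : IsNuclear S) (F : Finset S)
    {ε : ℝ} (hε : 0 < ε) : ∃ p : UCPFactorization S, ∀ a ∈ F, ‖p.ρ (p.σ a) - a‖ < ε := by
  obtain ⟨I, _, _, _, ν, ψ, φ, hψ, hφ, h⟩ := hS
  have h1 : 0 < ‖(1 : S)‖ := OperatorSystem.norm_one_pos
  have h2 : ∀ a, Tendsto (fun i => ‖φ i (ψ i a) - a‖) atTop (𝓝 0) := fun a =>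
    tendsto_iff_norm_sub_tendsto_zero.1 (h a)
  -- The estimate of `exists_ucp_of_cpc` carries a factor `‖1‖` on the left, so the target is
  -- `ε‖1‖`; the factor is cancelled at the end.
  have h3 : ∀ᶠ i in atTop, ∀ a ∈ F,
      ‖φ i (ψ i a) - a‖ * ‖(1 : S)‖ + 2 * ‖a‖ * ‖φ i (ψ i 1) - 1‖ < ε * ‖(1 : S)‖ := by
    rw [Filter.eventually_all_finset]
    intro a _
    have := ((h2 a).mul_const ‖(1 : S)‖).add ((h2 1).const_mul (2 * ‖a‖))
    exact this.eventually_lt_const (by simpa using mul_pos hε h1)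
  obtain ⟨i, hi, hi1⟩ := (h3.and ((h2 1).eventually_lt_const h1)).exists
  obtain ⟨hν, σ, ρ, hσ, hρ, hb⟩ := exists_ucp_of_cpc (hψ i) (hφ i) hi1
  exact ⟨⟨ν i, hν, σ, ρ, hσ, hρ⟩, fun a ha =>
    lt_of_mul_lt_mul_right ((hb a).trans_lt (hi a ha)) h1.le⟩

end Unitization

/-! ### Complete order embeddings are isometric -/

section Maps

variable {S : Type u} {T : Type v} [OperatorSystem S] [OperatorSystem T]

theorem IsCompleteOrderEmbedding.isUCP {f : S →ₗ[ℂ] T} (hf : IsCompleteOrderEmbedding f) :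
    IsUCP f :=
  ⟨hf.map_one, fun n A hA => (hf.map_mem_iff n A).2 hA⟩

/-- The order norm is read off from positivity of `2 × 2` blocks, which such an embedding reflects.
-/
theorem IsCompleteOrderEmbedding.norm_map {f : S →ₗ[ℂ] T} (hf : IsCompleteOrderEmbedding f)
    (a : S) : ‖f a‖ = ‖a‖ := by
  refine le_antisymm (hf.isUCP.norm_map_le a) (le_of_forall_pos_le_add fun ε hε => ?_)
  refine OperatorSystem.norm_le_of_block (by positivity) ((hf.map_mem_iff _ _).1 ?_)
  convert OperatorSystem.block_mem_of_norm_lt (lt_add_of_pos_right ‖f a‖ hε) using 1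
  ext i j
  fin_cases i <;> fin_cases j <;>
    simp [OperatorSystem.block, hf.map_one, hf.isUCP.cp.map_star, -Complex.coe_smul]

/-- A ucp map as a continuous linear map. -/
noncomputable def IsUCP.toCLM {f : S →ₗ[ℂ] T} (hf : IsUCP f) : S →L[ℂ] T :=
  f.mkContinuous 1 fun a => by simpa using hf.norm_map_le a

@[simp]
theorem IsUCP.toCLM_apply {f : S →ₗ[ℂ] T} (hf : IsUCP f) (a : S) : hf.toCLM a = f a := rfl

theorem IsUCP.continuous {f : S →ₗ[ℂ] T} (hf : IsUCP f) : Continuous f := hf.toCLM.continuous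

end Maps

/-! ### Identification of the limit space by approximations -/

namespace SoftInductiveSystem

variable {N : Type v} [Preorder N] {T : N → Type w} [∀ n, OperatorSystem (T n)]
  (J : SoftInductiveSystem N T)

/-- The correcting net is `-a n` at the indices where `a n` is not positive and `0` elsewhere; it is
bounded and eventually zero, hence null. -/
theorem map_lim_mem_limitPos_of_eventually {k : ℕ} {a : Matrix (Fin k) (Fin k) J.convergent}
    (h : ∀ᶠ n in atTop, entry a n ∈ OperatorSystem.pos k) : a.map J.lim ∈ J.limitPos k := by
  classical
  rw [map_lim_mem_limitPos]
  intro ε hε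
  have hb : ∀ p q, (fun n => if entry a n ∈ OperatorSystem.pos k then 0 else -(a p q).1 n)
      ∈ null T := fun p q => by
    obtain ⟨C, hC⟩ := (a p q).2.1
    refine ⟨⟨C, fun n => ?_⟩, tendsto_const_nhds.congr' ?_⟩
    · dsimp only
      split_ifs
      · simpa using (norm_nonneg _).trans (hC n)
      · simpa using hC n
    · filter_upwards [h] with n hn
      simp [hn]
  refine ⟨Matrix.of fun p q => ⟨_, hb p q⟩, fun n => ?_⟩
  have h1 := OperatorSystem.pos_smul hε.le (OperatorSystem.one_mem (S := T n) k)
  by_cases hn : entry a n ∈ OperatorSystem.pos k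
  · have e : ∀ c : Matrix (Fin k) (Fin k) (null T), (∀ p q, (c p q).1 n = 0) → entry c n = 0 :=
      fun c hc => by ext p q; exact hc p q
    rw [e _ fun p q => if_pos hn, add_zero]
    exact OperatorSystem.pos_add h1 hn
  · have e : ∀ c : Matrix (Fin k) (Fin k) (null T), (∀ p q, (c p q).1 n = -(a p q).1 n) →
        entry c n = -entry a n := fun c hc => by ext p q; exact hc p q
    rw [e _ fun p q => if_neg hn, add_neg_cancel_right]
    exact h1

theorem norm_lim_le {a : J.convergent} {r : ℝ} (hr : 0 ≤ r) (h : ∀ᶠ n in atTop, ‖a.1 n‖ ≤ r) :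
    ‖J.lim a‖ ≤ r := by
  refine le_of_forall_pos_le_add fun ε hε => ?_
  refine OperatorSystem.norm_le_of_block (by positivity) ?_
  have h1 := J.map_lim_mem_limitPos_of_eventually (k := 2)
    (a := !![((r + ε : ℝ) : ℂ) • J.oneNet, a; J.starNet a, ((r + ε : ℝ) : ℂ) • J.oneNet]) (by
      filter_upwards [h] with n hn
      convert OperatorSystem.block_mem_of_norm_lt (a := a.1 n) (r := r + ε) (by linarith) using 1
      ext i j
      fin_cases i <;> fin_cases j <;> rfl)
  have e : OperatorSystem.block (r + ε) (J.lim a) = Matrix.map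
      !![((r + ε : ℝ) : ℂ) • J.oneNet, a; J.starNet a, ((r + ε : ℝ) : ℂ) • J.oneNet] J.lim := by
    ext i j
    fin_cases i <;> fin_cases j <;>
      simp [OperatorSystem.block, one_def, star_lim, -Complex.coe_smul]
  rw [e]
  exact h1

/-- Pairs of ucp maps between an operator system `S` and the members of a soft inductive system
that approximate the identity of `S` and asymptotically implement the connecting maps. -/
structure Approximation (S : Type u) [OperatorSystem S] where
  σ : ∀ n, S →ₗ[ℂ] T n
  ρ : ∀ n, T n →ₗ[ℂ] S
  ucp_σ : ∀ n, IsUCP (σ n)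
  ucp_ρ : ∀ n, IsUCP (ρ n)
  tendsto : ∀ a, Tendsto (fun n => ρ n (σ n a)) atTop (𝓝 a)
  δ : N → ℝ
  tendsto_δ : Tendsto δ atTop (𝓝 0)
  -- Uniformity in `y` allows the vector to vary with `m`, as for the entries of a net.
  norm_j_sub_σ_le : ∀ m, ∀ᶠ n in atTop, ∀ y, ‖J.j n m y - σ n (ρ m y)‖ ≤ δ m * ‖y‖

variable {J}

namespace Approximation

variable {S : Type u} [OperatorSystem S] (P : J.Approximation S)

theorem tendsto_norm (a : S) : Tendsto (fun n => ‖P.ρ n (P.σ n a) - a‖) atTop (𝓝 0) :=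
  tendsto_iff_norm_sub_tendsto_zero.1 (P.tendsto a)

theorem norm_j_sub_le (m : N) : ∀ᶠ n in atTop, ∀ (y : T m) (z : S),
    ‖J.j n m y - P.σ n z‖ ≤ P.δ m * ‖y‖ + ‖P.ρ m y - z‖ := by
  filter_upwards [P.norm_j_sub_σ_le m] with n hn y z
  have h1 : J.j n m y - P.σ n z = (J.j n m y - P.σ n (P.ρ m y)) + P.σ n (P.ρ m y - z) := by
    rw [map_sub]; abel
  rw [h1]
  exact (norm_add_le _ _).trans (add_le_add (hn y) ((P.ucp_σ n).norm_map_le _))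

theorem δ_mul_norm_le {m : N} {C : ℝ} {y : T m} (hy : ‖y‖ ≤ C) :
    P.δ m * ‖y‖ ≤ |P.δ m| * C :=
  mul_le_mul (le_abs_self _) hy (norm_nonneg _) (abs_nonneg _)

theorem tendsto_abs_δ_mul (C : ℝ) : Tendsto (fun m => |P.δ m| * C) atTop (𝓝 0) := by
  simpa using P.tendsto_δ.abs.mul_const C

/-- Taking `y = σ m a` and `z = a` in `norm_j_sub_le` bounds the defect by `|δ m| ‖a‖ + ‖ρ m (σ m a)
- a‖`. -/
theorem mem_convergent (a : S) : (fun n => P.σ n a) ∈ J.convergent := by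
  refine ⟨⟨‖a‖, fun n => (P.ucp_σ n).norm_map_le a⟩, fun ε hε => ?_⟩
  have h := (P.tendsto_abs_δ_mul ‖a‖).add (P.tendsto_norm a)
  rw [add_zero] at h
  filter_upwards [h.eventually_lt_const hε] with m hm
  filter_upwards [P.norm_j_sub_le m] with n hn
  rw [norm_sub_rev]
  have h1 := P.δ_mul_norm_le ((P.ucp_σ m).norm_map_le a)
  linarith [hn (P.σ m a) a]

/-- The canonical map of `S` into the limit space. -/
noncomputable def toLimit : S →ₗ[ℂ] J.Limit :=
  J.lim ∘ₗ (LinearMap.pi P.σ).codRestrict J.convergent P.mem_convergent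

theorem toLimit_apply (a : S) : P.toLimit a = J.lim ⟨fun n => P.σ n a, P.mem_convergent a⟩ := rfl

/-- Positivity in the limit, tested on approximations. -/
theorem eventually_ρ_mem {k : ℕ} {a : Matrix (Fin k) (Fin k) J.convergent}
    (ha : a.map J.lim ∈ J.limitPos k) {ε : ℝ} (hε : 0 < ε) :
    ∃ c : N → Matrix (Fin k) (Fin k) S, (∀ p q, Tendsto (fun n => c n p q) atTop (𝓝 0)) ∧
      ∀ n, (ε : ℂ) • (1 : Matrix (Fin k) (Fin k) S) + (entry a n).map (P.ρ n) + c n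
        ∈ OperatorSystem.pos k := by
  rw [map_lim_mem_limitPos] at ha
  obtain ⟨b, hb⟩ := ha ε hε
  refine ⟨fun n => (entry b n).map (P.ρ n), fun p q => ?_, fun n => ?_⟩
  · rw [tendsto_zero_iff_norm_tendsto_zero]
    exact squeeze_zero (fun _ => norm_nonneg _) (fun n => (P.ucp_ρ n).norm_map_le _) (b p q).2.2
  · have h := (P.ucp_ρ n).cp k _ (hb n)
    rwa [OperatorSystem.map_add_map, OperatorSystem.map_add_map, OperatorSystem.map_smul_map,
      OperatorSystem.map_one_map (P.ucp_ρ n).map_one] at h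

/-- For `n ≫ m`, `σ n (ρ m (x m))` is close to `j n m (x m)`, and this to `x n`. Both the density of
the range and the positivity of the splitting rest on this. -/
theorem tendsto_toLimit (x : J.convergent) :
    Tendsto (fun m => P.toLimit (P.ρ m (x.1 m))) atTop (𝓝 (J.lim x)) := by
  rw [Metric.tendsto_nhds]
  intro ε hε
  obtain ⟨C, hC⟩ := x.2.1
  filter_upwards [x.2.2 (ε / 4) (by positivity),
    (P.tendsto_abs_δ_mul C).eventually_lt_const (show 0 < ε / 4 by positivity)] with m h1 h2
  rw [dist_eq_norm, toLimit_apply, ← map_sub]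
  refine (J.norm_lim_le (r := ε / 2) (by positivity) ?_).trans_lt (half_lt_self hε)
  filter_upwards [h1, P.norm_j_sub_σ_le m] with n h3 h4
  have h5 : P.σ n (P.ρ m (x.1 m)) - x.1 n
      = -((x.1 n - J.j n m (x.1 m)) + (J.j n m (x.1 m) - P.σ n (P.ρ m (x.1 m)))) := by abel
  change ‖P.σ n (P.ρ m (x.1 m)) - x.1 n‖ ≤ ε / 2
  rw [h5, norm_neg]
  have h6 := norm_add_le (x.1 n - J.j n m (x.1 m)) (J.j n m (x.1 m) - P.σ n (P.ρ m (x.1 m)))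
  linarith [h4 (x.1 m), P.δ_mul_norm_le (hC m)]

variable [IsDirectedOrder N] [Nonempty N]

/-- To reflect positivity, `ρ n` is applied to `r 1 + σ n A + b n ≥ 0` with `b` null; the result
tends to `r 1 + A`, and `r` is arbitrary. -/
theorem isCompleteOrderEmbedding_toLimit : IsCompleteOrderEmbedding P.toLimit where
  map_one := by
    rw [toLimit_apply, one_def]
    congr 1
    ext n
    exact (P.ucp_σ n).map_one
  map_mem_iff k A := by
    have e : A.map P.toLimit = (A.map fun a => (⟨_, P.mem_convergent a⟩ : J.convergent)).map
      J.lim := rfl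
    change A.map P.toLimit ∈ J.limitPos k ↔ _
    rw [e]
    refine ⟨fun h => ?_, fun h => ?_⟩
    · refine OperatorSystem.archimedean fun r hr => ?_
      obtain ⟨c, hc, hm⟩ := P.eventually_ρ_mem h hr
      refine OperatorSystem.mem_of_tendsto (l := atTop) (Eventually.of_forall hm) fun p q => ?_
      simpa [entry, -Complex.coe_smul] using
        (tendsto_const_nhds.add (P.tendsto (A p q))).add (hc p q)
    · exact J.map_lim_mem_limitPos_of_eventually
        (Eventually.of_forall fun n => (P.ucp_σ n).cp k A h)

theorem denseRange_toLimit : DenseRange P.toLimit := fun x => by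
  obtain ⟨a, rfl⟩ := J.lim_surjective x
  exact mem_closure_of_tendsto (P.tendsto_toLimit a) (Eventually.of_forall fun m => ⟨_, rfl⟩)

theorem isometry_toLimit : Isometry P.toLimit :=
  AddMonoidHomClass.isometry_of_norm P.toLimit P.isCompleteOrderEmbedding_toLimit.norm_map

theorem isLimitOf (P : J.Approximation S) : IsLimitOf S J :=
  ⟨P.toLimit, P.isCompleteOrderEmbedding_toLimit, P.denseRange_toLimit, fun _ =>
    ⟨P.isCompleteOrderEmbedding_toLimit, P.isometry_toLimit.injective, by
      -- The isometric image of a complete space is closed, so density gives surjectivity.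
      rw [← Set.range_eq_univ,
        ← P.isometry_toLimit.isClosedEmbedding.isClosed_range.closure_eq]
      exact P.denseRange_toLimit.closure_eq⟩⟩

variable [∀ n, CompleteSpace (T n)]

/-- The continuous extension of `σ n` to the limit space. -/
noncomputable def ofLimit (n : N) : J.Limit →L[ℂ] T n :=
  (P.ucp_σ n).toCLM.extend P.isCompleteOrderEmbedding_toLimit.isUCP.toCLM

theorem ofLimit_toLimit (n : N) (a : S) : P.ofLimit n (P.toLimit a) = P.σ n a :=
  ContinuousLinearMap.extend_eq (P.ucp_σ n).toCLM
    (e := P.isCompleteOrderEmbedding_toLimit.isUCP.toCLM) P.denseRange_toLimit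
    P.isometry_toLimit.isUniformInducing a

theorem tendsto_ofLimit (n : N) (x : J.convergent) :
    Tendsto (fun m => P.σ n (P.ρ m (x.1 m))) atTop (𝓝 (P.ofLimit n (J.lim x))) := by
  simpa only [Function.comp_def, ofLimit_toLimit] using
    ((P.ofLimit n).continuous.tendsto _).comp (P.tendsto_toLimit x)

/-- For a positive limit with lift `a`, `ρ m` gives `r 1 + ρ m (a m) + c m ≥ 0` in `S` with `c m →
0`. Applying `σ n` and letting `m → ∞` gives positivity, up to `r 1`, of the image under `ofLimit
n`. -/
theorem isUCP_ofLimit (n : N) : IsUCP (P.ofLimit n : J.Limit →ₗ[ℂ] T n) where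
  map_one := by
    rw [← P.isCompleteOrderEmbedding_toLimit.map_one]
    exact (P.ofLimit_toLimit n 1).trans (P.ucp_σ n).map_one
  cp k A hA := by
    obtain ⟨a, rfl⟩ := J.exists_lift A
    refine OperatorSystem.archimedean fun r hr => ?_
    obtain ⟨c, hc, hm⟩ := P.eventually_ρ_mem hA hr
    refine OperatorSystem.mem_of_tendsto (l := atTop)
      (Eventually.of_forall fun m => (P.ucp_σ n).cp k _ (hm m)) fun p q => ?_
    have h1 : Tendsto (fun m => P.σ n (c m p q)) atTop (𝓝 0) := by
      simpa [Function.comp_def] using ((P.ucp_σ n).continuous.tendsto 0).comp (hc p q)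
    have h2 := ((tendsto_const_nhds (x := (r : ℂ) • (1 : Matrix (Fin k) (Fin k) (T n)) p q)).add
      (P.tendsto_ofLimit n (a p q))).add h1
    rw [add_zero] at h2
    refine h2.congr fun m => ?_
    have h3 : (1 : Matrix (Fin k) (Fin k) (T n)) p q = P.σ n ((1 : Matrix (Fin k) (Fin k) S) p q) :=
      (congrFun (congrFun (OperatorSystem.map_one_map (P.ucp_σ n).map_one) p) q).symm
    rw [h3]
    simp [entry, -Complex.coe_smul]

theorem norm_ofLimit_le (n : N) (x : J.Limit) : ‖P.ofLimit n x‖ ≤ ‖x‖ :=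
  (P.isUCP_ofLimit n).norm_map_le x

/-- On the range of `toLimit` the net is `σ n a`, which converges; density and contractivity give
the rest by an `ε/3` argument. -/
theorem ofLimit_mem_convergent (x : J.Limit) : (fun n => P.ofLimit n x) ∈ J.convergent := by
  refine ⟨⟨‖x‖, fun n => P.norm_ofLimit_le n x⟩, fun ε hε => ?_⟩
  obtain ⟨a, ha⟩ := P.denseRange_toLimit.exists_dist_lt x (show 0 < ε / 3 by positivity)
  rw [dist_eq_norm] at ha
  filter_upwards [(P.mem_convergent a).2 (ε / 3) (by positivity)] with m hm
  filter_upwards [hm] with n hn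
  have h1 : P.ofLimit n x - J.j n m (P.ofLimit m x)
      = P.ofLimit n (x - P.toLimit a) + (P.σ n a - J.j n m (P.σ m a))
        - J.j n m (P.ofLimit m (x - P.toLimit a)) := by
    rw [map_sub, map_sub, map_sub, ofLimit_toLimit, ofLimit_toLimit]
    abel
  rw [h1]
  have h2 := norm_sub_le (P.ofLimit n (x - P.toLimit a) + (P.σ n a - J.j n m (P.σ m a)))
    (J.j n m (P.ofLimit m (x - P.toLimit a)))
  have h3 := norm_add_le (P.ofLimit n (x - P.toLimit a)) (P.σ n a - J.j n m (P.σ m a))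
  have h4 := P.norm_ofLimit_le n (x - P.toLimit a)
  have h5 := (J.norm_j_le n m _).trans (P.norm_ofLimit_le m (x - P.toLimit a))
  linarith

/-- The splitting of `j-lim` given by the maps `ofLimit`. -/
noncomputable def splitting : J.Limit →ₗ[ℂ] J.convergent :=
  (LinearMap.pi fun n => (P.ofLimit n : J.Limit →ₗ[ℂ] T n)).codRestrict J.convergent
    P.ofLimit_mem_convergent

theorem lim_splitting (x : J.Limit) : J.lim (P.splitting x) = x := by
  have hc : Continuous (J.lim ∘ₗ P.splitting) :=
    ((J.lim ∘ₗ P.splitting).mkContinuous 1 fun x => by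
      rw [one_mul]
      exact J.norm_lim_le (norm_nonneg x)
        (Eventually.of_forall fun n => P.norm_ofLimit_le n x)).continuous
  refine congrFun (P.denseRange_toLimit.equalizer hc continuous_id (funext fun a => ?_)) x
  change J.lim (P.splitting (P.toLimit a)) = P.toLimit a
  rw [toLimit_apply]
  congr 1
  ext n
  exact P.ofLimit_toLimit n a

theorem isSplit (P : J.Approximation S) : J.IsSplit :=
  ⟨P.splitting, fun x n => P.norm_ofLimit_le n x, P.isUCP_ofLimit, P.lim_splitting⟩

end Approximation

end SoftInductiveSystem

/-! ### Soft systems with connecting maps `σ n ∘ ρ m` -/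

namespace SoftInductiveSystem

section OfUCP

variable {S : Type u} [OperatorSystem S] {N : Type v} [PartialOrder N] {T : N → Type w}
  [∀ n, OperatorSystem (T n)]

open scoped Classical in
/-- The connecting maps `σ n ∘ ρ m` for `m < n`, extended to all pairs of indices. -/
noncomputable def connecting (σ : ∀ n, S →ₗ[ℂ] T n) (ρ : ∀ n, T n →ₗ[ℂ] S) (n m : N) :
    T m →ₗ[ℂ] T n :=
  if h : m = n then h ▸ LinearMap.id else if m ≤ n then σ n ∘ₗ ρ m else 0

theorem connecting_self (σ : ∀ n, S →ₗ[ℂ] T n) (ρ : ∀ n, T n →ₗ[ℂ] S) (n : N) :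
    connecting σ ρ n n = LinearMap.id := dif_pos rfl

theorem connecting_of_lt (σ : ∀ n, S →ₗ[ℂ] T n) (ρ : ∀ n, T n →ₗ[ℂ] S) {n m : N} (h : m < n) :
    connecting σ ρ n m = σ n ∘ₗ ρ m := by
  rw [connecting, dif_neg h.ne, if_pos h.le]

/-- The soft inductive system with connecting maps `σ n ∘ ρ m` defined by ucp maps that
approximate the identity of `S`. -/
noncomputable def ofUCP (σ : ∀ n, S →ₗ[ℂ] T n) (ρ : ∀ n, T n →ₗ[ℂ] S) (hσ : ∀ n, IsUCP (σ n))
    (hρ : ∀ n, IsUCP (ρ n)) (h : ∀ a, Tendsto (fun n => ρ n (σ n a)) atTop (𝓝 a)) :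
    SoftInductiveSystem N T where
  j := connecting σ ρ
  ucp {n m} hmn := by
    rcases hmn.eq_or_lt with rfl | hlt
    · rw [connecting_self]
      exact IsUCP.id
    · rw [connecting_of_lt _ _ hlt]
      exact (hσ n).comp (hρ m)
  refl := connecting_self σ ρ
  not_le {n m} hmn := by
    rw [connecting, dif_neg fun e => hmn e.le, if_neg hmn]
  asymp_trans l a ε hε := by
    -- For `l < m < n` the defect is `σ n (b - ρ m (σ m b))` with `b = ρ l a`; it vanishes if two
    -- adjacent indices coincide.
    have h1 := tendsto_iff_norm_sub_tendsto_zero.1 (h (ρ l a))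
    filter_upwards [h1.eventually_lt_const hε, eventually_ge_atTop l] with m hm hlm
    filter_upwards [eventually_ge_atTop m] with n hmn
    rcases hlm.eq_or_lt with rfl | hlm
    · simpa [connecting_self] using hε
    rcases hmn.eq_or_lt with rfl | hmn
    · simpa [connecting_self] using hε
    rw [connecting_of_lt _ _ hlm, connecting_of_lt _ _ hmn, connecting_of_lt _ _ (hlm.trans hmn)]
    simp only [LinearMap.comp_apply]
    rw [← map_sub, norm_sub_rev] at *
    exact ((hσ n).norm_map_le _).trans_lt hm

/-- The approximation of `S` by the soft inductive system `ofUCP`. -/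
noncomputable def ofUCPApproximation [NoMaxOrder N] [IsDirectedOrder N] (σ : ∀ n, S →ₗ[ℂ] T n)
    (ρ : ∀ n, T n →ₗ[ℂ] S) (hσ : ∀ n, IsUCP (σ n))
    (hρ : ∀ n, IsUCP (ρ n)) (h : ∀ a, Tendsto (fun n => ρ n (σ n a)) atTop (𝓝 a)) :
    (ofUCP σ ρ hσ hρ h).Approximation S where
  σ := σ
  ρ := ρ
  ucp_σ := hσ
  ucp_ρ := hρ
  tendsto := h
  δ := 0
  tendsto_δ := tendsto_const_nhds
  norm_j_sub_σ_le m := by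
    -- The identity `j n m = σ n ∘ ρ m` fails at `n = m`, so strictly larger indices are needed;
    -- `NoMaxOrder` provides them.
    filter_upwards [eventually_gt_atTop m] with n hn y
    simp [ofUCP, connecting_of_lt _ _ hn]

end OfUCP

/-! ### Strict systems over `ℕ` from one-step maps -/

section OfSteps

variable {T : ℕ → Type w} [∀ n, OperatorSystem (T n)]

/-- The compositions of the maps `step m`, …, `step (n - 1)`, extended to all pairs of indices. -/
noncomputable def stepComp (step : ∀ n, T n →ₗ[ℂ] T (n + 1)) : ∀ n m : ℕ, T m →ₗ[ℂ] T n
  | 0, m => if h : m = 0 then h ▸ LinearMap.id else 0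
  | n + 1, m => if h : m = n + 1 then h ▸ LinearMap.id else step n ∘ₗ stepComp step n m

variable (step : ∀ n, T n →ₗ[ℂ] T (n + 1))

theorem stepComp_self : ∀ n, stepComp step n n = LinearMap.id
  | 0 => dif_pos rfl
  | _ + 1 => dif_pos rfl

theorem stepComp_succ {n m : ℕ} (h : m ≤ n) :
    stepComp step (n + 1) m = step n ∘ₗ stepComp step n m := by
  rw [stepComp, dif_neg (by omega)]

theorem stepComp_of_lt {n m : ℕ} (h : n < m) : stepComp step n m = 0 := by
  induction n with
  | zero => rw [stepComp, dif_neg (by omega)]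
  | succ n ih => rw [stepComp, dif_neg (by omega), ih (by omega), LinearMap.comp_zero]

theorem stepComp_comp {l m n : ℕ} (hlm : l ≤ m) (hmn : m ≤ n) :
    stepComp step n m ∘ₗ stepComp step m l = stepComp step n l := by
  induction n, hmn using Nat.le_induction with
  | base => rw [stepComp_self, LinearMap.id_comp]
  | succ n hmn ih =>
    rw [stepComp_succ step hmn, stepComp_succ step (hlm.trans hmn), LinearMap.comp_assoc, ih]

theorem isUCP_stepComp (h : ∀ n, IsUCP (step n)) {m n : ℕ} (hmn : m ≤ n) :
    IsUCP (stepComp step n m) := by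
  induction n, hmn using Nat.le_induction with
  | base => rw [stepComp_self]; exact IsUCP.id
  | succ n hmn ih => rw [stepComp_succ step hmn]; exact (h n).comp ih

/-- The strict inductive system over `ℕ` determined by its one-step connecting maps. -/
noncomputable def ofSteps (h : ∀ n, IsUCP (step n)) : SoftInductiveSystem ℕ T where
  j := stepComp step
  ucp hmn := isUCP_stepComp step h hmn
  refl := stepComp_self step
  not_le hmn := stepComp_of_lt step (Nat.lt_of_not_le hmn)
  asymp_trans l a ε hε := by
    filter_upwards [eventually_ge_atTop l] with m hm
    filter_upwards [eventually_ge_atTop m] with n hn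
    rw [← stepComp_comp step hm hn]
    simpa using hε

theorem isStrict_ofSteps (h : ∀ n, IsUCP (step n)) : (ofSteps step h).IsStrict :=
  fun hlm hmn => stepComp_comp step hlm hmn

variable {S : Type u} [OperatorSystem S]

/-- The approximation of `S` by a strict inductive system with one-step connecting maps
`σ (n + 1) ∘ ρ n`, where `ρ (n + 1) ∘ σ (n + 1)` is summably close to the identity on the range
of `ρ n`. -/
noncomputable def ofStepsApproximation (σ : ∀ n, S →ₗ[ℂ] T n)
    (ρ : ∀ n, T n →ₗ[ℂ] S) (hσ : ∀ n, IsUCP (σ n))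
    (hρ : ∀ n, IsUCP (ρ n)) (h : ∀ a, Tendsto (fun n => ρ n (σ n a)) atTop (𝓝 a))
    (hs : ∀ n y, ‖ρ (n + 1) (σ (n + 1) (ρ n y)) - ρ n y‖ ≤ (1 / 2) ^ n * ‖y‖) :
    (ofSteps (fun n => σ (n + 1) ∘ₗ ρ n) fun n => (hσ (n + 1)).comp (hρ n)).Approximation S where
  σ := σ
  ρ := ρ
  ucp_σ := hσ
  ucp_ρ := hρ
  tendsto := h
  -- The sum of the one-step errors `2⁻ᵏ` over `k ≥ m`.
  δ m := 2 * (1 / 2) ^ m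
  tendsto_δ := by
    simpa using (tendsto_pow_atTop_nhds_zero_of_lt_one (r := (1 / 2 : ℝ)) (by norm_num)
      (by norm_num)).const_mul 2
  norm_j_sub_σ_le m := by
    set step : ∀ n, T n →ₗ[ℂ] T (n + 1) := fun n => σ (n + 1) ∘ₗ ρ n with hstep
    -- Telescoping: the constant is the sum of `2⁻ᵏ` over `m ≤ k < n`.
    have key : ∀ n, m ≤ n → ∀ y, ‖ρ n (stepComp step n m y) - ρ m y‖
        ≤ (2 * (1 / 2) ^ m - 2 * (1 / 2) ^ n) * ‖y‖ := by
      intro n hmn y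
      induction n, hmn using Nat.le_induction with
      | base => simp [stepComp_self]
      | succ n hmn ih =>
        rw [stepComp_succ step hmn]
        have h1 := hs n (stepComp step n m y)
        have h2 := (isUCP_stepComp step (fun n => (hσ (n + 1)).comp (hρ n)) hmn).norm_map_le y
        have h3 := norm_sub_le_norm_sub_add_norm_sub
          (ρ (n + 1) (σ (n + 1) (ρ n (stepComp step n m y)))) (ρ n (stepComp step n m y)) (ρ m y)
        have h4 : (1 / 2 : ℝ) ^ n * ‖stepComp step n m y‖ ≤ (1 / 2) ^ n * ‖y‖ := by gcongr
        change ‖ρ (n + 1) (σ (n + 1) (ρ n (stepComp step n m y))) - ρ m y‖ ≤ _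
        rw [pow_succ]
        linarith
    filter_upwards [eventually_gt_atTop m] with n hn y
    -- At target index `m + n + 1` the last step begins with `ρ (m + n)`, so both terms are images
    -- under `σ (m + n + 1)`, and `key` applies at `m + n`.
    obtain ⟨n, rfl⟩ := Nat.exists_eq_add_of_lt hn
    change ‖stepComp step (m + n + 1) m y - _‖ ≤ _
    rw [stepComp_succ step (by omega)]
    change ‖σ (m + n + 1) (ρ (m + n) (stepComp step (m + n) m y)) - σ (m + n + 1) (ρ m y)‖ ≤ _
    rw [← map_sub]
    refine ((hσ _).norm_map_le _).trans ((key (m + n) (by omega) y).trans ?_)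
    gcongr
    have : (0 : ℝ) ≤ 2 * (1 / 2) ^ (m + n) := by positivity
    linarith

end OfSteps

end SoftInductiveSystem

/-! ### Choice of the factorizations and conclusion -/

section Main

variable {S : Type u} [OperatorSystem S]

/-- Contractions that converge to the identity on a dense set converge to it everywhere. -/
theorem tendsto_id_of_dense {ι : Type*} {l : Filter ι} {f : ι → S →ₗ[ℂ] S}
    (hf : ∀ i, IsUCP (f i)) {D : Set S} (hD : Dense D)
    (h : ∀ d ∈ D, Tendsto (fun i => f i d) l (𝓝 d)) (a : S) :
    Tendsto (fun i => f i a) l (𝓝 a) := by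
  rw [Metric.tendsto_nhds]
  intro ε hε
  obtain ⟨d, hd, had⟩ := hD.exists_dist_lt a (show 0 < ε / 3 by positivity)
  filter_upwards [Metric.tendsto_nhds.1 (h d hd) (ε / 3) (by positivity)] with i hi
  rw [dist_eq_norm] at *
  have h1 : f i a - a = f i (a - d) + (f i d - d) - (a - d) := by rw [map_sub]; abel
  rw [h1]
  have h2 := norm_sub_le (f i (a - d) + (f i d - d)) (a - d)
  have h3 := norm_add_le (f i (a - d)) (f i d - d)
  have h4 := (hf i).norm_map_le (a - d)
  linarith

/-- On the image of a finite-dimensional operator system the norm of a map is controlled by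
finitely many vectors. -/
theorem exists_finset_norm_le {T : Type v} [OperatorSystem T] [FiniteDimensional ℂ T]
    (R : T →ₗ[ℂ] S) {ε : ℝ} (hε : 0 < ε) :
    ∃ (F : Finset S) (η : ℝ), 0 < η ∧ ∀ G : S →ₗ[ℂ] S, (∀ a ∈ F, ‖G a‖ ≤ η) →
      ∀ y, ‖G (R y)‖ ≤ ε * ‖y‖ := by
  classical
  -- `C` bounds the operator norm by the values on a basis, whence `η = ε / C`. `G` need not be
  -- continuous, since `G ∘ₗ R` has finite-dimensional domain.
  obtain ⟨C, hC, h⟩ := (Module.finBasis ℂ T).exists_opNorm_le (F := S)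
  refine ⟨Finset.univ.image fun i => R (Module.finBasis ℂ T i), ε / C, by positivity,
    fun G hG y => ?_⟩
  have h1 := h (u := LinearMap.toContinuousLinearMap (G ∘ₗ R)) (M := ε / C) (by positivity)
    fun i => hG _ (Finset.mem_image_of_mem _ (Finset.mem_univ i))
  rw [mul_div_cancel₀ _ hC.ne'] at h1
  exact (LinearMap.toContinuousLinearMap (G ∘ₗ R)).le_of_opNorm_le h1 y

theorem IsNuclear.exists_ucpFactorization_extending [Nontrivial S] (hS : IsNuclear S)
    (F : Finset S) {ε : ℝ} (hε : 0 < ε) (p : UCPFactorization S) :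
    ∃ q : UCPFactorization S, (∀ a ∈ F, ‖q.ρ (q.σ a) - a‖ < ε) ∧
      ∀ y, ‖q.ρ (q.σ (p.ρ y)) - p.ρ y‖ ≤ ε * ‖y‖ := by
  classical
  obtain ⟨F', η, hη, h⟩ := exists_finset_norm_le p.ρ hε
  obtain ⟨q, hq⟩ := hS.exists_ucpFactorization (F ∪ F') (lt_min hε hη)
  refine ⟨q, fun a ha => (hq a (Finset.mem_union_left _ ha)).trans_le (min_le_left _ _),
    fun y => ?_⟩
  have h1 : ∀ a ∈ F', ‖(q.ρ ∘ₗ q.σ - LinearMap.id : S →ₗ[ℂ] S) a‖ ≤ η := fun a ha =>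
    ((hq a (Finset.mem_union_right _ ha)).trans_le (min_le_right _ _)).le
  exact h _ h1 y

instance instCompleteSpaceMatrix (ν : ℕ) : CompleteSpace (Matrix (Fin ν) (Fin ν) ℂ) :=
  FiniteDimensional.complete ℂ _

theorem IsNuclear.exists_soft [Nontrivial S] (hS : IsNuclear S) :
    ∃ (N : Type u) (_ : PartialOrder N) (_ : IsDirectedOrder N) (_ : Nonempty N)
      (ν : N → ℕ) (_ : ∀ n, 0 < ν n) (J : SoftMatrixSystem N ν), J.IsSplit ∧ IsLimitOf S J := by
  classical
  -- The finite set lists the vectors to be approximated. The factor `ℕ` gives the tolerance `1 / (k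
  -- + 1)` and rules out maximal indices.
  choose p hp using fun n : Finset S × ℕ =>
    hS.exists_ucpFactorization n.1 (Nat.one_div_pos_of_nat (α := ℝ) (n := n.2))
  have h : ∀ a, Tendsto (fun n => (p n).ρ ((p n).σ a)) atTop (𝓝 a) := by
    intro a
    rw [tendsto_iff_norm_sub_tendsto_zero]
    have h1 : Tendsto (fun n : Finset S × ℕ => 1 / ((n.2 : ℝ) + 1)) atTop (𝓝 0) := by
      rw [← prod_atTop_atTop_eq]
      exact tendsto_one_div_add_atTop_nhds_zero_nat.comp tendsto_snd
    refine squeeze_zero' (Eventually.of_forall fun _ => norm_nonneg _) ?_ h1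
    filter_upwards [eventually_ge_atTop (({a}, 0) : Finset S × ℕ)] with n hn
    exact (hp n a (hn.1 (Finset.mem_singleton_self a))).le
  have P := SoftInductiveSystem.ofUCPApproximation (fun n => (p n).σ) (fun n => (p n).ρ)
    (fun n => (p n).ucp_σ) (fun n => (p n).ucp_ρ) h
  exact ⟨Finset S × ℕ, inferInstance, inferInstance, inferInstance, fun n => (p n).ν,
    fun n => (p n).ν_pos, _, P.isSplit, P.isLimitOf⟩

theorem IsNuclear.exists_strict [Nontrivial S] (hS : IsNuclear S)
    [TopologicalSpace.SeparableSpace S] :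
    ∃ (ν : ℕ → ℕ) (_ : ∀ n, 0 < ν n) (J : SoftMatrixSystem ℕ ν),
        J.IsStrict ∧ J.IsSplit ∧ IsLimitOf S J := by
  classical
  obtain ⟨p₀, -⟩ := hS.exists_ucpFactorization ∅ one_pos
  set d := TopologicalSpace.denseSeq S
  -- Stage `n` controls `d 0, …, d n` and the range of the preceding `ρ`, both with tolerance `2⁻ⁿ`.
  choose q hq hq' using fun (n : ℕ) (p : UCPFactorization S) =>
    hS.exists_ucpFactorization_extending ((Finset.range (n + 1)).image d)
      (show (0 : ℝ) < (1 / 2) ^ n by positivity) p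
  let p : ℕ → UCPFactorization S := fun n => Nat.rec p₀ q n
  have h : ∀ a, Tendsto (fun n => (p n).ρ ((p n).σ a)) atTop (𝓝 a) := by
    refine tendsto_id_of_dense (f := fun n => (p n).ρ ∘ₗ (p n).σ)
      (fun n => (p n).ucp_ρ.comp (p n).ucp_σ) (TopologicalSpace.denseRange_denseSeq S) ?_
    rintro _ ⟨i, rfl⟩
    -- The estimates of stage `n` concern `p (n + 1) = q n (p n)`, hence the shift by one.
    rw [← tendsto_add_atTop_iff_nat 1, tendsto_iff_norm_sub_tendsto_zero]
    refine squeeze_zero' (Eventually.of_forall fun _ => norm_nonneg _) ?_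
      (tendsto_pow_atTop_nhds_zero_of_lt_one (r := (1 / 2 : ℝ)) (by norm_num) (by norm_num))
    filter_upwards [eventually_ge_atTop i] with n hn
    exact (hq n (p n) (d i) (Finset.mem_image_of_mem _ (Finset.mem_range.2 (by omega)))).le
  have P := SoftInductiveSystem.ofStepsApproximation (fun n => (p n).σ) (fun n => (p n).ρ)
    (fun n => (p n).ucp_σ) (fun n => (p n).ucp_ρ) h fun n => hq' n (p n)
  exact ⟨fun n => (p n).ν, fun n => (p n).ν_pos, _,
    SoftInductiveSystem.isStrict_ofSteps _ _, P.isSplit, P.isLimitOf⟩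

end Main

theorem mainTheorem3 {S : Type u} [OperatorSystem S] [Nontrivial S] (hS : IsNuclear S) :
    (∃ (N : Type u) (_ : PartialOrder N) (_ : IsDirectedOrder N) (_ : Nonempty N)
      (ν : N → ℕ) (_ : ∀ n, 0 < ν n) (J : SoftMatrixSystem N ν),
      J.IsSplit ∧ IsLimitOf S J) ∧
    (TopologicalSpace.SeparableSpace S →
      ∃ (ν : ℕ → ℕ) (_ : ∀ n, 0 < ν n) (J : SoftMatrixSystem ℕ ν),
        J.IsStrict ∧ J.IsSplit ∧ IsLimitOf S J) :=
  ⟨hS.exists_soft, fun _ => hS.exists_strict⟩
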